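/- Setting. Let $n\ge 4$, $k\ge 2$, and let $\sigma^*\in[k]^n$ be balanced: $|\{i:\sigma^*_i=a\}|=n/k$ for each $a\in[k]$. Let $Y^*\in\{0,1\}^{n\times n}$, $Y^*_{ij}=1$ iff $\sigma^*_i=\sigma^*_j$; let $\|M\|_1=\sum_{i,j}|M_{ij}|$; and for $\hat\sigma\in[k]^n$ let $$\mathrm{err}(\hat\sigma,\sigma^*)=\min_{\pi\in S_k}\tfrac1n\,|\{i\in[n]:\hat\sigma_i\ne\pi(\sigma^*_i)\}|.$$ The procedure $\mathtt{cluster}(Y,n,k)$, for $Y\in\mathbb R^{n\times n}$, is as follows. First step: start with $V=[n]$; while $V\neq\emptyset$, form for each $u\in V$ the ball $B(u)=\{w\in V:\|Y_{u\bullet}-Y_{w\bullet}\|_1\le \frac{n}{4k}\}$ of rows, take a ball $B_t$ of largest cardinality, remove arbitrary elements from it so that $|B_t|=n/k$ if $|B_t|>n/k$, and replace $V$ by $V\setminus B_t$. Second step: choose $k$ largest sets among the $B_t$ and name them $U_1,\dots,U_k$, distribute the elements of the other sets arbitrarily so that $|U_t|=n/k$ for each $t\in[k]$, and output the vector $\hat\sigma\in[k]^n$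 with $\hat\sigma_i=t$ for $i\in U_t$. Theorem. (1) There is a universal constant $C>0$ such that for all such $n,k,\sigma^*$, every $\hat Y\in\mathbb R^{n\times n}$ and every possible output $\hat\sigma$ of $\mathtt{cluster}(\hat Y,n,k)$, $$\mathrm{err}(\hat\sigma,\sigma^*)\le C\,\frac{\|\hat Y-Y^*\|_1}{\|Y^*\|_1}.$$ (2) There are universal constants $C_s,C_m,C_e>0$ with the following property. Let $\mu_1,\dots,\mu_k\in\mathbb R^d$, let $\tau>0$, and let $h_i=\mu_{\sigma^*_i}+g_i$, $i\in[n]$, where $g_1,\dots,g_n$ are independent mean-zero random vectors in $\mathbb R^d$ with $\|g_i\|_{\psi_2}\le\tau$; here $\|x\|_{\psi_2}=\sup_{\|u\|_2=1}\|\langle x,u\rangle\|_{\psi_2}$ for a random vector $x$, and $\|X\|_{\psi_2}=\inf\{t>0:\mathbb E\exp(X^2/t^2)\le 2\}$ for a random variable $X$. Let $s=\tau^{-1}\min_{a\ne b}\|\mu_a-\mu_b\|_2$, and suppose that $$s^2\ \ge\ C_s\Big(\sqrt{\tfrac{kd}{n}\log n}+\tfrac{kd}{n}+k\Big).$$ Then,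 with probability at least $1-2/n$, for every minimizer $\hat Y$ of $\sum_{i,j}Y_{ij}\|h_i-h_j\|_2^2$ over the symmetric positive semidefinite $Y\in\mathbb R^{n\times n}$ with nonnegative entries, with $Y_{ii}=1$ for all $i$, and with all row sums equal to $n/k$, and for every possible output $\hat\sigma$ of $\mathtt{cluster}(\hat Y,n,k)$, $$\mathrm{err}(\hat\sigma,\sigma^*)\le C_m\exp(-s^2/C_e).$$ -/

import Mathlib

open MeasureTheory ProbabilityTheory
open scoped ENNReal

universe u

noncomputable section

namespace ClusterSDP

/-! ### Sub-Gaussian norms -/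

/-- The sub-Gaussian norm `inf {t > 0 : E exp (X ^ 2 / t ^ 2) ≤ 2}` of a real random variable, with
value `∞` if there is no such `t`. -/
def psi2Norm {Ω : Type u} [MeasurableSpace Ω] (P : Measure Ω) (X : Ω → ℝ) : ℝ≥0∞ :=
  ⨅ (t : ℝ) (_ : 0 < t)
    (_ : ∫⁻ ω, ENNReal.ofReal (Real.exp (X ω ^ 2 / t ^ 2)) ∂P ≤ 2), ENNReal.ofReal t

/-- The sub-Gaussian norm of a random vector: the supremum of the sub-Gaussian norms of its
one-dimensional marginals along unit vectors. -/
def vecPsi2Norm {Ω : Type u} [MeasurableSpace Ω] (P : Measure Ω) {d : ℕ}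
    (x : Ω → EuclideanSpace ℝ (Fin d)) : ℝ≥0∞ :=
  ⨆ (v : EuclideanSpace ℝ (Fin d)) (_ : ‖v‖ = 1), psi2Norm P (fun ω => inner ℝ (x ω) v)

/-! ### The mixture model -/

/-- All `k` clusters have the same size `n / k`. -/
def IsBalanced {n k : ℕ} (σ : Fin n → Fin k) : Prop :=
  ∀ a : Fin k, k * (Finset.univ.filter (fun i => σ i = a)).card = n

/-- The noise vectors and the true labels of a sub-Gaussian mixture model with `k` balanced
clusters and noise level `τ`. -/
structure IsSGMM {Ω : Type u} [MeasurableSpace Ω] (P : Measure Ω) {n k d : ℕ}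
    (σ : Fin n → Fin k) (g : Fin n → Ω → EuclideanSpace ℝ (Fin d)) (τ : ℝ) : Prop where
  balanced : IsBalanced σ
  measurable : ∀ i, Measurable (g i)
  indep : iIndepFun g P
  centered : ∀ i, ∫ ω, g i ω ∂P = 0
  subGaussian : ∀ i, vecPsi2Norm P (g i) ≤ ENNReal.ofReal τ

/-- The data points `h i = μ (σ i) + g i`, for one realization `g` of the noise. -/
def dataPoint {n k d : ℕ} (μ : Fin k → EuclideanSpace ℝ (Fin d)) (σ : Fin n → Fin k)
    (g : Fin n → EuclideanSpace ℝ (Fin d)) (i : Fin n) : EuclideanSpace ℝ (Fin d) :=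
  μ (σ i) + g i

/-- The minimum separation of the cluster centers. -/
def minSep {k d : ℕ} (μ : Fin k → EuclideanSpace ℝ (Fin d)) : ℝ :=
  ⨅ p : {p : Fin k × Fin k // p.1 ≠ p.2}, ‖μ p.1.1 - μ p.1.2‖

/-- The signal-to-noise ratio. -/
def snr {k d : ℕ} (μ : Fin k → EuclideanSpace ℝ (Fin d)) (τ : ℝ) : ℝ :=
  minSep μ / τ

/-! ### The semidefinite program -/

/-- The entrywise `ℓ₁` norm of a matrix. -/
def l1Norm {n : ℕ} (M : Matrix (Fin n) (Fin n) ℝ) : ℝ :=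
  ∑ i, ∑ j, |M i j|

/-- The cluster matrix of a label vector. -/
def clusterMatrix {n k : ℕ} (σ : Fin n → Fin k) : Matrix (Fin n) (Fin n) ℝ :=
  Matrix.of fun i j => if σ i = σ j then 1 else 0

/-- The matrix of pairwise squared distances. -/
def distMatrix {n d : ℕ} (h : Fin n → EuclideanSpace ℝ (Fin d)) : Matrix (Fin n) (Fin n) ℝ :=
  Matrix.of fun i j => ‖h i - h j‖ ^ 2

/-- The feasible set of the semidefinite program. -/
structure IsFeasible {n : ℕ} (k : ℕ) (Y : Matrix (Fin n) (Fin n) ℝ) : Prop where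
  row_sum : ∀ i, ∑ j, Y i j = (n : ℝ) / k
  posSemidef : Y.PosSemidef
  diag : ∀ i, Y i i = 1
  nonneg : ∀ i j, 0 ≤ Y i j

/-- `Y` is an optimal solution of the semidefinite program with cost matrix `A`: it minimizes
`⟨Y, A⟩ = Tr (Yᵀ A)` over the feasible set. -/
def IsSDPSolution {n : ℕ} (k : ℕ) (A Y : Matrix (Fin n) (Fin n) ℝ) : Prop :=
  IsFeasible k Y ∧
    ∀ Z : Matrix (Fin n) (Fin n) ℝ, IsFeasible k Z → (Y.transpose * A).trace ≤ (Z.transpose * A).trace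

/-! ### The rounding procedure

The procedure makes arbitrary choices, so it is given as a relation between its input and its
possible outputs. -/

/-- The indices `w ∈ V` for which row `w` of `Y` has `ℓ₁` distance at most `n / (4 k)` from row
`u`. -/
def rowBall {n : ℕ} (k : ℕ) (Y : Matrix (Fin n) (Fin n) ℝ) (V : Finset (Fin n)) (u : Fin n) :
    Finset (Fin n) :=
  V.filter fun w => ∑ j, |Y u j - Y w j| ≤ (n : ℝ) / (4 * k)

/-- `B` may be extracted while `V` is the set of remaining indices: `B` is a largest ball around a
row in `V`, cut down arbitrarily to `n / k` elements if it has more than that. -/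
def IsExtracted {n : ℕ} (k : ℕ) (Y : Matrix (Fin n) (Fin n) ℝ) (V B : Finset (Fin n)) : Prop :=
  ∃ u ∈ V, (∀ v ∈ V, (rowBall k Y V v).card ≤ (rowBall k Y V u).card) ∧
    ((rowBall k Y V u).card ≤ n / k ∧ B = rowBall k Y V u ∨
      n / k < (rowBall k Y V u).card ∧ B ⊆ rowBall k Y V u ∧ B.card = n / k)

/-- `FirstStep k Y V L`: starting from the set `V` of remaining indices, the loop of the first step
may extract the sets in `L`, in this order, until no index remains. -/
inductive FirstStep {n : ℕ} (k : ℕ) (Y : Matrix (Fin n) (Fin n) ℝ) :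
    Finset (Fin n) → List (Finset (Fin n)) → Prop
  | done : FirstStep k Y ∅ []
  | extract (V B : Finset (Fin n)) (L : List (Finset (Fin n))) :
      V.Nonempty → IsExtracted k Y V B → FirstStep k Y (V \ B) L → FirstStep k Y V (B :: L)

/-- `SecondStep L σ`: the second step, run on the sets in `L`, may output the labels `σ`. The
injection `e` picks (and names) `k` largest sets, and `U t` is the `t`-th of them after the elements
of the other sets have been distributed. -/
def SecondStep {n k : ℕ} (L : List (Finset (Fin n))) (σ : Fin n → Fin k) : Prop :=
  ∃ (e : Fin k ↪ Fin L.length) (U : Fin k → Finset (Fin n)),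
    (∀ (t : Fin k) (s : Fin L.length), s ∉ Set.range e → (L.get s).card ≤ (L.get (e t)).card) ∧
    (∀ t, L.get (e t) ⊆ U t) ∧
    (∀ t, (U t).card = n / k) ∧
    (∀ i t, i ∈ U t ↔ σ i = t)

/-- `σ` is a possible output of `cluster (Y, n, k)`. -/
def IsClusterOutput {n k : ℕ} (Y : Matrix (Fin n) (Fin n) ℝ) (σ : Fin n → Fin k) : Prop :=
  ∃ L : List (Finset (Fin n)), FirstStep k Y Finset.univ L ∧ SecondStep L σ

/-- The fraction of misclassified points, modulo permutations of the labels. -/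
def misRate {n k : ℕ} (τ σ : Fin n → Fin k) : ℝ :=
  ⨅ π : Equiv.Perm (Fin k),
    ((Finset.univ.filter (fun i => τ i ≠ π (σ i))).card : ℝ) / n

end ClusterSDP

end

namespace ClusterSDP

/-! ### Analysis of the rounding procedure -/

/-! Write m = n/k. Rounding: call a row of Y good if its l1 distance to the corresponding row of the
cluster matrix is at most m/8. Good rows of one cluster lie within the ball radius m/4 of each
other, while rows of the cluster matrix from different clusters are 2m apart, so no ball contains
good rows of two clusters (`FirstStep.exists_main`). The greedy loop therefore finds, for each
cluster with a good row, its own set, at least as large as its good part. Counting shows that at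
most three times the number of bad rows are mislabelled (`exists_perm_card_ne_le`), and Markov's
inequality bounds the number of bad rows.

Semidefinite program: split each data point as c + x, where c is the center plus the cluster mean of
the noise and x is the centered noise. The row sums make the norms of x contribute a constant, so
comparison with the cluster matrix bounds the signal and cross terms by the inner product of Y with
the Gram matrix of x. A factorization of Y bounds the latter by a small multiple of `offDiagMass`,
the quantity to be controlled (`IsFeasible.sum_inner_sub_clusterMean_le`). The signal absorbs
everything else except the linear noise along differences of centers, which is replaced by a level X
j for each point (`IsSDPSolution.offDiagMass_le`).

Probability: three facts are needed. A net argument bounds the quadratic form of the noise.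
Decoupling makes a noise vector nearly orthogonal to the noise means. Finally, the sum of the levels
is at most of order τ² n exp(-c s²), with c > 0 universal (`IsSGMM.holdsExcept_exists_level`). The
last fact uses independence through the expectation of a product of terms 1 + W, together with a
union bound when the target is too small for that, the regime where all levels vanish. -/

lemma IsExtracted.exists_subset_rowBall {n k : ℕ} {Y : Matrix (Fin n) (Fin n) ℝ}
    {V B : Finset (Fin n)} (h : IsExtracted k Y V B) :
    ∃ u ∈ V, B ⊆ rowBall k Y V u := by
  obtain ⟨u, hu, -, ⟨-, rfl⟩ | ⟨-, hB, -⟩⟩ := h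
  · exact ⟨u, hu, subset_rfl⟩
  · exact ⟨u, hu, hB⟩

/-- Each ball around a point of S contains S, so the largest ball is at least as large as S.
Trimming does no harm, because it stops at n/k, which S does not exceed. -/
lemma IsExtracted.card_le {n k : ℕ} {Y : Matrix (Fin n) (Fin n) ℝ}
    {V B S : Finset (Fin n)} (h : IsExtracted k Y V B) (hS : S.card ≤ n / k)
    (hne : S.Nonempty) (hV : ∀ v ∈ S, S ⊆ rowBall k Y V v) : S.card ≤ B.card := by
  obtain ⟨v, hv⟩ := hne
  have hvV : v ∈ V := (Finset.mem_filter.1 (hV v hv hv)).1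
  have hSv := Finset.card_le_card (hV v hv)
  obtain ⟨u, hu, hmax, ⟨_, rfl⟩ | ⟨_, hB, hc⟩⟩ := h
  · exact hSv.trans (hmax v hvV)
  · exact hc ▸ hS

lemma IsExtracted.subset {n k : ℕ} {Y : Matrix (Fin n) (Fin n) ℝ}
    {V B : Finset (Fin n)} (h : IsExtracted k Y V B) : B ⊆ V := by
  obtain ⟨u, _, hB⟩ := h.exists_subset_rowBall
  exact hB.trans (Finset.filter_subset _ _)

lemma FirstStep.mem_iff {n k : ℕ} {Y : Matrix (Fin n) (Fin n) ℝ} {V : Finset (Fin n)}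
    {L : List (Finset (Fin n))} (h : FirstStep k Y V L) (i : Fin n) :
    i ∈ V ↔ ∃ s : Fin L.length, i ∈ L.get s := by
  induction h with
  | done => simp
  | extract V B L _ hB _ ih =>
    have hBV := hB.subset
    constructor
    · intro hi
      by_cases hiB : i ∈ B
      · exact ⟨⟨0, by simp⟩, hiB⟩
      · obtain ⟨s, hs⟩ := ih.1 (Finset.mem_sdiff.2 ⟨hi, hiB⟩)
        exact ⟨s.succ, hs⟩
    · rintro ⟨s, hs⟩
      obtain ⟨s, hlt⟩ := s
      cases s with
      | zero => exact hBV hs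
      | succ s =>
        exact (Finset.mem_sdiff.1 (ih.2 ⟨⟨s, by simpa using hlt⟩, hs⟩)).1

lemma FirstStep.disjoint {n k : ℕ} {Y : Matrix (Fin n) (Fin n) ℝ} {V : Finset (Fin n)}
    {L : List (Finset (Fin n))} (h : FirstStep k Y V L) :
    ∀ s t : Fin L.length, s ≠ t → Disjoint (L.get s) (L.get t) := by
  induction h with
  | done => intro s; exact s.elim0
  | extract V B L _ hB hL ih =>
    have key : ∀ t : Fin L.length, Disjoint B (L.get t) := fun t =>
      Finset.disjoint_left.2 fun i hi hit =>
        (Finset.mem_sdiff.1 ((hL.mem_iff i).2 ⟨t, hit⟩)).2 hi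
    rintro ⟨s, hs⟩ ⟨t, ht⟩ hst
    cases s with
    | zero =>
      cases t with
      | zero => exact absurd rfl hst
      | succ t => exact key ⟨t, by simpa using ht⟩
    | succ s =>
      cases t with
      | zero => exact (key ⟨s, by simpa using hs⟩).symm
      | succ t =>
        exact ih ⟨s, by simpa using hs⟩ ⟨t, by simpa using ht⟩ fun h => hst (by
          simpa using h)

/-- If the groups `good a` have radius at most the ball radius and no ball meets two groups, then no
extracted set meets two groups, and each group has an extracted set which meets it and is at least
as large. -/
lemma FirstStep.exists_main {n k : ℕ} {Y : Matrix (Fin n) (Fin n) ℝ} {V : Finset (Fin n)}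
    {L : List (Finset (Fin n))} (h : FirstStep k Y V L) (good : Fin k → Finset (Fin n))
    (hclose : ∀ a, ∀ u ∈ good a, ∀ w ∈ good a, ∑ j, |Y u j - Y w j| ≤ (n : ℝ) / (4 * k))
    (hcard : ∀ a, (good a).card ≤ n / k)
    (hsep : ∀ u, ∀ a b, ∀ v ∈ good a, ∀ w ∈ good b, v ∈ rowBall k Y Finset.univ u →
      w ∈ rowBall k Y Finset.univ u → a = b) :
    (∀ s : Fin L.length, ∀ a b, ∀ v ∈ good a, ∀ w ∈ good b, v ∈ L.get s → w ∈ L.get s → a = b) ∧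
      ∀ a, (V ∩ good a).Nonempty →
        ∃ s : Fin L.length, (L.get s ∩ good a).Nonempty ∧
          (V ∩ good a).card ≤ (L.get s).card := by
  induction h with
  | done => exact ⟨fun s => s.elim0, fun a ⟨i, hi⟩ => by simp at hi⟩
  | extract V B L _ hB hL ih =>
    obtain ⟨ih1, ih2⟩ := ih
    constructor
    · rintro ⟨s, hs⟩ a b v hv w hw hvs hws
      cases s with
      | zero =>
        obtain ⟨u, _, hBu⟩ := hB.exists_subset_rowBall
        have hmono : rowBall k Y V u ⊆ rowBall k Y Finset.univ u :=
          Finset.filter_subset_filter _ (Finset.subset_univ _)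
        exact hsep u a b v hv w hw (hmono (hBu hvs)) (hmono (hBu hws))
      | succ s => exact ih1 ⟨s, by simpa using hs⟩ a b v hv w hw hvs hws
    · intro a hne
      by_cases hBa : (B ∩ good a).Nonempty
      · refine ⟨⟨0, by simp⟩, hBa, ?_⟩
        -- The remaining part of the group has diameter at most the radius, so it competes as a
        -- whole with the extracted ball.
        refine hB.card_le ((Finset.card_le_card Finset.inter_subset_right).trans (hcard a)) hne ?_
        intro v hv w hw
        exact Finset.mem_filter.2 ⟨(Finset.mem_inter.1 hw).1,
          hclose a v (Finset.mem_inter.1 hv).2 w (Finset.mem_inter.1 hw).2⟩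
      -- An extraction which misses the group leaves it intact, so induction loses nothing.
      · have hVB : (V \ B) ∩ good a = V ∩ good a := by
          ext i
          simp only [Finset.mem_inter, Finset.mem_sdiff]
          constructor
          · rintro ⟨⟨h1, _⟩, h2⟩; exact ⟨h1, h2⟩
          · rintro ⟨h1, h2⟩
            exact ⟨⟨h1, fun hi => hBa ⟨i, Finset.mem_inter.2 ⟨hi, h2⟩⟩⟩, h2⟩
        obtain ⟨s, hs1, hs2⟩ := ih2 a (hVB ▸ hne)
        exact ⟨s.succ, hs1, hVB ▸ hs2⟩

/-- The supremum of f over A separates the values on A from those on B. -/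
lemma sum_le_sum_of_card_le {ι : Type*} {A B : Finset ι} {f : ι → ℕ} (hcard : A.card ≤ B.card)
    (hf : ∀ a ∈ A, ∀ b ∈ B, f a ≤ f b) : ∑ a ∈ A, f a ≤ ∑ b ∈ B, f b := by
  calc ∑ a ∈ A, f a ≤ A.card * A.sup f := by
        simpa using Finset.sum_le_card_nsmul A f (A.sup f) fun a ha => Finset.le_sup ha
    _ ≤ B.card * A.sup f := Nat.mul_le_mul_right _ hcard
    _ ≤ ∑ b ∈ B, f b := by
        simpa using Finset.card_nsmul_le_sum B f (A.sup f) fun b hb =>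
          Finset.sup_le fun a ha => hf a ha b hb

/-- A partial injection of a finite type into itself extends to a permutation. -/
lemma exists_perm_extending {α : Type*} [Fintype α] [DecidableEq α] (p : α → Prop) (f : α → α)
    (hf : ∀ a b, p a → p b → f a = f b → a = b) : ∃ π : Equiv.Perm α, ∀ a, p a → π a = f a := by
  classical
  let F : {a // p a} ↪ α := ⟨fun a => f a, fun a b h => Subtype.ext (hf a b a.2 b.2 h)⟩
  let e : {a // p a} ≃ {b // b ∈ Set.range F} := Equiv.ofInjective F F.injective
  exact ⟨e.extendSubtype, fun a ha => e.extendSubtype_apply_of_mem a ha⟩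

/-- With β bad points, the main sets of the clusters cover at least n - β points, so the other sets
total at most β. A main set that is not selected is beaten in size by a selected set that is not
main; hence the unselected main sets also total at most β. Every good point in a selected main set
is labelled consistently, which leaves at most 3β errors. -/
lemma exists_perm_card_ne_le {n k : ℕ} {σ σhat : Fin n → Fin k} {L : List (Finset (Fin n))}
    (G : Fin n → Prop) [DecidablePred G]
    (hcover : ∀ i, ∃ s : Fin L.length, i ∈ L.get s)
    (hdisj : ∀ s t : Fin L.length, s ≠ t → Disjoint (L.get s) (L.get t))
    (hone : ∀ s : Fin L.length, ∀ v w, G v → G w → v ∈ L.get s → w ∈ L.get s → σ v = σ w)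
    (hmain : ∀ a, (∃ i, σ i = a ∧ G i) → ∃ s : Fin L.length, (∃ i ∈ L.get s, σ i = a ∧ G i) ∧
      (Finset.univ.filter fun i => σ i = a ∧ G i).card ≤ (L.get s).card)
    (hsecond : SecondStep L σhat) :
    ∃ π : Equiv.Perm (Fin k), (Finset.univ.filter fun i => σhat i ≠ π (σ i)).card ≤
      3 * (Finset.univ.filter fun i => ¬ G i).card := by
  classical
  obtain ⟨e, U, hlarge, heU, -, hU⟩ := hsecond
  set N : Fin k → Prop := fun a => ∃ i, σ i = a ∧ G i with hN
  set β := (Finset.univ.filter fun i => ¬ G i).card with hβ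
  have hmain' : ∀ a, ∃ s : Fin L.length, N a → (∃ i ∈ L.get s, σ i = a ∧ G i) ∧
      (Finset.univ.filter fun i => σ i = a ∧ G i).card ≤ (L.get s).card := fun a => by
    by_cases ha : N a
    · obtain ⟨s, hs⟩ := hmain a ha
      exact ⟨s, fun _ => hs⟩
    · exact ⟨e a, fun h => absurd h ha⟩
  choose f hf using hmain'
  have hf1 := fun a ha => (hf a ha).1
  have hf2 := fun a ha => (hf a ha).2
  set Main : Finset (Fin L.length) := (Finset.univ.filter N).image f with hMain
  set Sel : Finset (Fin L.length) := Finset.univ.image e with hSel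
  have hfinj : ∀ a b, N a → N b → f a = f b → a = b := by
    intro a b ha hb hab
    obtain ⟨i, hi, rfl, hGi⟩ := hf1 a ha
    obtain ⟨j, hj, rfl, hGj⟩ := hf1 b hb
    exact hone _ i j hGi hGj hi (hab ▸ hj)
  have htotal : ∑ s, (L.get s).card = n := by
    rw [← Finset.card_biUnion fun s _ t _ hst => hdisj s t hst]
    have : Finset.univ.biUnion L.get = Finset.univ := by
      ext i; simpa using hcover i
    rw [this]; simp
  have hgood : ∑ a ∈ Finset.univ.filter N, (Finset.univ.filter fun i => σ i = a ∧ G i).card + β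
      = n := by
    have h1 : ∑ a ∈ Finset.univ.filter N, (Finset.univ.filter fun i => σ i = a ∧ G i).card
        = (Finset.univ.filter G).card := by
      rw [Finset.card_eq_sum_card_fiberwise (f := σ) (t := Finset.univ.filter N)]
      · refine Finset.sum_congr rfl fun a _ => ?_
        rw [Finset.filter_filter]
        simp only [and_comm]
      · intro i hi
        simp only [Finset.coe_filter, Finset.mem_univ, true_and, Set.mem_ofPred_eq] at hi ⊢
        exact ⟨i, rfl, hi⟩
    rw [h1, hβ, Finset.card_filter_add_card_filter_not]; simp
  have hmainsum : ∑ a ∈ Finset.univ.filter N, (Finset.univ.filter fun i => σ i = a ∧ G i).card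
      ≤ ∑ s ∈ Main, (L.get s).card := by
    rw [hMain, Finset.sum_image fun a ha b hb h =>
      hfinj a b (Finset.mem_filter.1 ha).2 (Finset.mem_filter.1 hb).2 h]
    exact Finset.sum_le_sum fun a ha => hf2 a (Finset.mem_filter.1 ha).2
  have hnonmain : ∑ s ∈ Mainᶜ, (L.get s).card ≤ β := by
    have := Finset.sum_add_sum_compl Main fun s => (L.get s).card
    omega
  have hcard : Main.card ≤ Sel.card := by
    rw [hSel, Finset.card_image_of_injective _ e.injective, hMain]
    exact Finset.card_image_le.trans (Finset.card_filter_le _ _)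
  have hexcl : ∑ s ∈ Main \ Sel, (L.get s).card ≤ β := by
    refine le_trans (sum_le_sum_of_card_le (B := Sel \ Main) ?_ ?_) (le_trans ?_ hnonmain)
    · exact Finset.card_sdiff_le_card_sdiff_iff.2 hcard
    · intro s hs t ht
      obtain ⟨t', -, rfl⟩ := Finset.mem_image.1 (Finset.mem_sdiff.1 ht).1
      refine hlarge t' s fun ⟨r, hr⟩ => (Finset.mem_sdiff.1 hs).2 ?_
      exact Finset.mem_image.2 ⟨r, Finset.mem_univ _, hr⟩
    · refine Finset.sum_le_sum_of_subset fun s hs => ?_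
      exact Finset.mem_compl.2 (Finset.mem_sdiff.1 hs).2
  have hsel : ∀ a, ∃ t, f a ∈ Sel → e t = f a := fun a => by
    by_cases ha : f a ∈ Sel
    · obtain ⟨t, -, ht⟩ := Finset.mem_image.1 ha
      exact ⟨t, fun _ => ht⟩
    · exact ⟨a, fun h => absurd h ha⟩
  choose q hq using hsel
  -- Only clusters whose main set is selected prescribe a label; the other values of the permutation
  -- are irrelevant.
  obtain ⟨π, hπ⟩ := exists_perm_extending (fun a => N a ∧ f a ∈ Sel) q
    fun a b ha hb hab => hfinj a b ha.1 hb.1 (by rw [← hq a ha.2, ← hq b hb.2, hab])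
  refine ⟨π, ?_⟩
  have hsub : (Finset.univ.filter fun i => σhat i ≠ π (σ i)) ⊆
      (Finset.univ.filter fun i => ¬ G i) ∪ (Mainᶜ.biUnion L.get ∪ (Main \ Sel).biUnion L.get) := by
    intro i hi
    have hne := (Finset.mem_filter.1 hi).2
    by_contra hcon
    simp only [Finset.mem_union, Finset.mem_filter, Finset.mem_univ, true_and, not_or, not_not,
      Finset.mem_biUnion, not_exists, not_and] at hcon
    obtain ⟨hG, h1, h2⟩ := hcon
    obtain ⟨s, hs⟩ := hcover i
    have hsM : s ∈ Main := by
      by_contra h; exact h1 s (Finset.mem_compl.2 h) hs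
    have hsS : s ∈ Sel := by
      by_contra h; exact h2 s (Finset.mem_sdiff.2 ⟨hsM, h⟩) hs
    obtain ⟨a, ha, rfl⟩ := Finset.mem_image.1 hsM
    have hNa := (Finset.mem_filter.1 ha).2
    obtain ⟨j, hj, rfl, hGj⟩ := hf1 a hNa
    have hij : σ i = σ j := hone _ i j hG hGj hs hj
    refine hne ?_
    rw [hij, hπ _ ⟨hNa, hsS⟩]
    refine (hU i _).1 (heU _ ?_)
    rw [hq _ hsS]
    exact hs
  have h3 := (Finset.card_le_card hsub).trans (Finset.card_union_le _ _)
  have h4 := Finset.card_union_le (Mainᶜ.biUnion L.get) ((Main \ Sel).biUnion L.get)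
  have h5 := (Finset.card_biUnion_le (s := Mainᶜ) (t := L.get)).trans hnonmain
  have h6 := (Finset.card_biUnion_le (s := Main \ Sel) (t := L.get)).trans hexcl
  omega

lemma IsBalanced.card_eq {n k : ℕ} {σ : Fin n → Fin k} (hσ : IsBalanced σ) (hk : 0 < k)
    (a : Fin k) : (Finset.univ.filter fun i => σ i = a).card = n / k := by
  exact (Nat.div_eq_of_eq_mul_right hk (hσ a).symm).symm

lemma IsBalanced.mul_div {n k : ℕ} {σ : Fin n → Fin k} (hσ : IsBalanced σ) (hk : 0 < k) :
    k * (n / k) = n := by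
  rw [← hσ.card_eq hk ⟨0, hk⟩, hσ]

lemma IsBalanced.cast_div {n k : ℕ} {σ : Fin n → Fin k} (hσ : IsBalanced σ) (hk : 0 < k) :
    (n : ℝ) / k = ((n / k : ℕ) : ℝ) := by
  have : (k : ℝ) ≠ 0 := by positivity
  rw [div_eq_iff this, mul_comm]
  exact_mod_cast (hσ.mul_div hk).symm

lemma sum_clusterMatrix {n k : ℕ} {σ : Fin n → Fin k} (hσ : IsBalanced σ) (hk : 0 < k)
    (i : Fin n) : ∑ j, clusterMatrix σ i j = (n : ℝ) / k := by
  rw [hσ.cast_div hk, ← hσ.card_eq hk (σ i)]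
  simp [clusterMatrix, eq_comm]

lemma l1Norm_clusterMatrix {n k : ℕ} {σ : Fin n → Fin k} (hσ : IsBalanced σ) (hk : 0 < k) :
    l1Norm (clusterMatrix σ) = n * ((n : ℝ) / k) := by
  have : ∀ i j, |clusterMatrix σ i j| = clusterMatrix σ i j := fun i j =>
    abs_of_nonneg (by simp only [clusterMatrix, Matrix.of_apply]; split_ifs <;> norm_num)
  simp only [l1Norm, this, sum_clusterMatrix hσ hk]
  simp

lemma sum_abs_clusterMatrix_sub {n k : ℕ} {σ : Fin n → Fin k} (hσ : IsBalanced σ) (hk : 0 < k)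
    {i j : Fin n} (hij : σ i ≠ σ j) :
    ∑ l, |clusterMatrix σ i l - clusterMatrix σ j l| = 2 * ((n : ℝ) / k) := by
  have : ∀ l, |clusterMatrix σ i l - clusterMatrix σ j l| =
      clusterMatrix σ i l + clusterMatrix σ j l := by
    intro l
    simp only [clusterMatrix, Matrix.of_apply]
    by_cases h1 : σ i = σ l
    · have h2 : σ j ≠ σ l := fun h => hij (h1.trans h.symm)
      simp [h1, h2]
    · by_cases h2 : σ j = σ l <;> simp [h1, h2]
  simp only [this, Finset.sum_add_distrib, sum_clusterMatrix hσ hk]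
  ring

lemma sum_abs_sub_le_add {n : ℕ} (x y z : Fin n → ℝ) :
    ∑ j, |x j - z j| ≤ ∑ j, |x j - y j| + ∑ j, |y j - z j| := by
  rw [← Finset.sum_add_distrib]
  exact Finset.sum_le_sum fun j _ => abs_sub_le _ _ _

lemma sum_abs_sub_comm {n : ℕ} (x y : Fin n → ℝ) :
    ∑ j, |x j - y j| = ∑ j, |y j - x j| :=
  Finset.sum_congr rfl fun _ _ => abs_sub_comm _ _

/-- The clustering procedure converts an approximation of the cluster matrix in `ℓ₁` norm into
labels with comparable error. -/
theorem misRate_le_l1Norm {n k : ℕ} (hn : 4 ≤ n) (hk : 2 ≤ k) {σ : Fin n → Fin k}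
    (hσ : IsBalanced σ) {Y : Matrix (Fin n) (Fin n) ℝ} {σhat : Fin n → Fin k}
    (h : IsClusterOutput Y σhat) :
    misRate σhat σ ≤ 24 * (l1Norm (Y - clusterMatrix σ) / l1Norm (clusterMatrix σ)) := by
  classical
  have hk0 : 0 < k := by omega
  have hkR : (0 : ℝ) < k := by positivity
  have hnR : (0 : ℝ) < n := by positivity
  obtain ⟨L, h1, h2⟩ := h
  set m : ℝ := (n : ℝ) / k with hm
  have hmpos : 0 < m := by positivity
  have hrad : (n : ℝ) / (4 * k) = m / 4 := by rw [hm]; field_simp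
  set ε : Fin n → ℝ := fun i => ∑ j, |Y i j - clusterMatrix σ i j| with hε
  -- The threshold is half the ball radius, so that the errors of two good rows add up to at most
  -- the radius.
  let G : Fin n → Prop := fun i => ε i ≤ m / 8
  have hclose : ∀ u w, G u → G w → σ u = σ w → ∑ j, |Y u j - Y w j| ≤ m / 4 := by
    intro u w hu hw huw
    have hrow : clusterMatrix σ u = clusterMatrix σ w := by
      ext l; simp [clusterMatrix, huw]
    have := sum_abs_sub_le_add (Y u) (clusterMatrix σ u) (Y w)
    rw [sum_abs_sub_comm (clusterMatrix σ u) (Y w)] at this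
    rw [hrow] at this
    have hu' : ∑ j, |Y u j - clusterMatrix σ w j| ≤ m / 8 := hrow ▸ hu
    have hw' : ∑ j, |Y w j - clusterMatrix σ w j| ≤ m / 8 := hw
    linarith
  have hsep : ∀ u v w, G v → G w → v ∈ rowBall k Y Finset.univ u →
      w ∈ rowBall k Y Finset.univ u → σ v = σ w := by
    intro u v w hv hw hvu hwu
    by_contra hne
    have e1 := sum_abs_clusterMatrix_sub hσ hk0 hne
    have e2 := (Finset.mem_filter.1 hvu).2
    have e3 := (Finset.mem_filter.1 hwu).2
    rw [hrad] at e2 e3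
    have e4 := sum_abs_sub_le_add (clusterMatrix σ v) (Y v) (clusterMatrix σ w)
    have e5 := sum_abs_sub_le_add (Y v) (Y w) (clusterMatrix σ w)
    have e6 := sum_abs_sub_le_add (Y v) (Y u) (Y w)
    rw [sum_abs_sub_comm (clusterMatrix σ v) (Y v)] at e4
    rw [sum_abs_sub_comm (Y v) (Y u)] at e6
    have hv' : ∑ j, |Y v j - clusterMatrix σ v j| ≤ m / 8 := hv
    have hw' : ∑ j, |Y w j - clusterMatrix σ w j| ≤ m / 8 := hw
    -- The triangle inequality would give 2m ≤ m/8 + m/4 + m/4 + m/8.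
    linarith
  have hfs := h1.exists_main (fun a => Finset.univ.filter fun i => σ i = a ∧ G i)
    (fun a u hu w hw => by
      simp only [Finset.mem_filter, Finset.mem_univ, true_and] at hu hw
      rw [hrad]
      exact hclose u w hu.2 hw.2 (hu.1.trans hw.1.symm))
    (fun a => by
      rw [← hσ.card_eq hk0 a]
      exact Finset.card_le_card (Finset.monotone_filter_right _ fun i _ hi => hi.1))
    (fun u a b v hv w hw hvu hwu => by
      simp only [Finset.mem_filter, Finset.mem_univ, true_and] at hv hw
      rw [← hv.1, ← hw.1]
      exact hsep u v w hv.2 hw.2 hvu hwu)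
  obtain ⟨π, hπ⟩ := exists_perm_card_ne_le (σ := σ) (σhat := σhat) G
    (fun i => (h1.mem_iff i).1 (Finset.mem_univ _)) h1.disjoint
    (fun s v w hv hw hvs hws => hfs.1 s (σ v) (σ w) v (by simp [hv]) w (by simp [hw]) hvs hws)
    (fun a ⟨i, hi⟩ => by
      obtain ⟨s, ⟨j, hj⟩, hs⟩ := hfs.2 a ⟨i, by simp [hi]⟩
      refine ⟨s, ⟨j, (Finset.mem_inter.1 hj).1, by simpa using (Finset.mem_inter.1 hj).2⟩, ?_⟩
      simpa using hs) h2
  have hbad : ((Finset.univ.filter fun i => ¬ G i).card : ℝ) * (m / 8) ≤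
      l1Norm (Y - clusterMatrix σ) := by
    calc ((Finset.univ.filter fun i => ¬ G i).card : ℝ) * (m / 8)
        ≤ ∑ i ∈ Finset.univ.filter (fun i => ¬ G i), ε i := by
          rw [← nsmul_eq_mul]
          exact Finset.card_nsmul_le_sum _ _ _ fun i hi =>
            (not_le.1 (Finset.mem_filter.1 hi).2).le
      _ ≤ ∑ i, ε i := Finset.sum_le_sum_of_subset_of_nonneg (Finset.filter_subset _ _)
          fun i _ _ => Finset.sum_nonneg fun _ _ => abs_nonneg _
      _ = l1Norm (Y - clusterMatrix σ) := by simp [l1Norm, hε]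
  rw [l1Norm_clusterMatrix hσ hk0]
  refine (ciInf_le (Set.finite_range _).bddBelow π).trans ?_
  have hπ' : ((Finset.univ.filter fun i => σhat i ≠ π (σ i)).card : ℝ) ≤
      3 * ((Finset.univ.filter fun i => ¬ G i).card : ℝ) := by exact_mod_cast hπ
  rw [div_le_iff₀ hnR]
  have : 24 * (l1Norm (Y - clusterMatrix σ) / (n * m)) * n =
      24 * l1Norm (Y - clusterMatrix σ) / m := by field_simp
  rw [this, le_div_iff₀ hmpos]
  nlinarith

/-! ### Deterministic analysis of the semidefinite program -/

section Averaging

variable {n k : ℕ} {σ : Fin n → Fin k}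

/-- Averaging over clusters fixes the functions which are constant on clusters. -/
lemma inv_smul_sum_clusterMatrix_smul {E : Type*} [AddCommGroup E] [Module ℝ E]
    (hσ : IsBalanced σ) (hk : 0 < k) (hn : 0 < n) {f : Fin n → E}
    (hf : ∀ i j, σ i = σ j → f i = f j) (i : Fin n) :
    ((n : ℝ) / k)⁻¹ • ∑ j, clusterMatrix σ i j • f j = f i := by
  have h1 : ∀ j, clusterMatrix σ i j • f j = clusterMatrix σ i j • f i := by
    intro j
    by_cases h : σ i = σ j
    · rw [hf i j h]
    · simp [clusterMatrix, h]
  simp only [h1]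
  rw [← Finset.sum_smul, sum_clusterMatrix hσ hk, smul_smul, inv_mul_cancel₀, one_smul]
  positivity

lemma clusterMatrix_comm (i j : Fin n) : clusterMatrix σ i j = clusterMatrix σ j i := by
  simp [clusterMatrix, eq_comm]

/-- The mean of the vectors `g j` over the cluster of the index `i`. -/
noncomputable def clusterMean {E : Type*} [AddCommGroup E] [Module ℝ E] (σ : Fin n → Fin k) (g : Fin n → E)
    (i : Fin n) : E :=
  ((n : ℝ) / k)⁻¹ • ∑ j, clusterMatrix σ i j • g j

lemma clusterMean_congr {E : Type*} [AddCommGroup E] [Module ℝ E] (g : Fin n → E) {i j : Fin n}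
    (h : σ i = σ j) : clusterMean σ g i = clusterMean σ g j := by
  simp [clusterMean, clusterMatrix, h]

lemma clusterMean_clusterMean {E : Type*} [AddCommGroup E] [Module ℝ E] (hσ : IsBalanced σ)
    (hk : 0 < k) (hn : 0 < n) (g : Fin n → E) (i : Fin n) :
    clusterMean σ (clusterMean σ g) i = clusterMean σ g i :=
  inv_smul_sum_clusterMatrix_smul hσ hk hn (fun _ _ h => clusterMean_congr g h) i

/-- Averaging over clusters is self-adjoint. -/
lemma sum_smul_clusterMean {E : Type*} [AddCommGroup E] [Module ℝ E] (c : Fin n → ℝ)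
    (g : Fin n → E) : ∑ i, c i • clusterMean σ g i = ∑ i, clusterMean σ c i • g i := by
  simp only [clusterMean, Finset.smul_sum, Finset.sum_smul]
  rw [Finset.sum_comm]
  refine Finset.sum_congr rfl fun i _ => Finset.sum_congr rfl fun j _ => ?_
  rw [clusterMatrix_comm i j]
  simp only [smul_smul, smul_eq_mul]
  congr 1
  ring

lemma sum_smul_sub_clusterMean {E : Type*} [AddCommGroup E] [Module ℝ E] (c : Fin n → ℝ)
    (g : Fin n → E) :
    ∑ i, c i • (g i - clusterMean σ g i) = ∑ i, (c i - clusterMean σ c i) • g i := by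
  simp only [smul_sub, sub_smul, Finset.sum_sub_distrib, sum_smul_clusterMean]

/-- Pythagoras for an orthogonal projection: averaging is self-adjoint and idempotent. -/
lemma sum_sub_clusterMean_sq (hσ : IsBalanced σ) (hk : 0 < k) (hn : 0 < n) (c : Fin n → ℝ) :
    ∑ i, (c i - clusterMean σ c i) ^ 2 = ∑ i, c i ^ 2 - ∑ i, c i * clusterMean σ c i := by
  have h := sum_smul_clusterMean (σ := σ) c (clusterMean σ c)
  simp only [clusterMean_clusterMean hσ hk hn, smul_eq_mul] at h
  have : ∀ i, (c i - clusterMean σ c i) ^ 2 =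
      c i ^ 2 - 2 * (c i * clusterMean σ c i) + clusterMean σ c i * clusterMean σ c i :=
    fun i => by ring
  simp only [this, Finset.sum_add_distrib, Finset.sum_sub_distrib, ← Finset.mul_sum, ← h]
  ring

end Averaging

/-! ### Feasible matrices and their mass outside the diagonal blocks. -/

section Feasible

variable {n k : ℕ} {Y : Matrix (Fin n) (Fin n) ℝ}

lemma IsFeasible.symm_apply (hY : IsFeasible k Y) (i j : Fin n) : Y i j = Y j i := by
  have := hY.posSemidef.isHermitian.apply j i
  simpa using this

lemma IsFeasible.exists_sum_mul (hY : IsFeasible k Y) :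
    ∃ (m : ℕ) (v : Fin m → Fin n → ℝ), ∀ i j, Y i j = ∑ l, v l i * v l j := by
  obtain ⟨m, v, hv⟩ := Matrix.posSemidef_iff_eq_sum_vecMulVec.mp hY.posSemidef
  refine ⟨m, v, fun i j => ?_⟩
  conv_lhs => rw [hv]
  simp [Matrix.sum_apply, Matrix.vecMulVec_apply]

/-- A Gram matrix of unit vectors has entries at most 1. -/
lemma IsFeasible.le_one (hY : IsFeasible k Y) (i j : Fin n) : Y i j ≤ 1 := by
  obtain ⟨m, v, hv⟩ := hY.exists_sum_mul
  have h1 := hY.diag i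
  have h2 := hY.diag j
  rw [hv] at h1 h2 ⊢
  have : ∑ l, v l i * v l j ≤ ∑ l, (v l i * v l i + v l j * v l j) / 2 :=
    Finset.sum_le_sum fun l _ => by nlinarith [sq_nonneg (v l i - v l j)]
  rw [← Finset.sum_div, Finset.sum_add_distrib, h1, h2] at this
  linarith

lemma isFeasible_clusterMatrix {σ : Fin n → Fin k} (hσ : IsBalanced σ) (hk : 0 < k) :
    IsFeasible k (clusterMatrix σ) where
  row_sum := sum_clusterMatrix hσ hk
  posSemidef := by
    have : clusterMatrix σ = (Matrix.of fun a i => if σ i = a then (1 : ℝ) else 0).conjTranspose *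
        (Matrix.of fun a i => if σ i = a then (1 : ℝ) else 0) := by
      ext i j
      simp [clusterMatrix, Matrix.mul_apply, eq_comm]
    rw [this]
    exact Matrix.posSemidef_conjTranspose_mul_self _
  diag i := by simp [clusterMatrix]
  nonneg i j := by simp only [clusterMatrix, Matrix.of_apply]; split_ifs <;> norm_num

/-- The total weight which `Y` puts on pairs of indices in different clusters. -/
noncomputable def offDiagMass (σ : Fin n → Fin k) (Y : Matrix (Fin n) (Fin n) ℝ) : ℝ :=
  ∑ i, ∑ j, if σ i = σ j then 0 else Y i j

lemma offDiagMass_eq_sub (σ : Fin n → Fin k) (Y : Matrix (Fin n) (Fin n) ℝ) :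
    offDiagMass σ Y = ∑ i, ∑ j, Y i j - ∑ i, ∑ j, Y i j * clusterMatrix σ i j := by
  simp only [offDiagMass, ← Finset.sum_sub_distrib]
  refine Finset.sum_congr rfl fun i _ => Finset.sum_congr rfl fun j _ => ?_
  by_cases h : σ i = σ j <;> simp [clusterMatrix, h]

/-- Entries of Y lie in [0, 1], so the difference has a fixed sign inside blocks and the opposite
one outside. Equal row sums make the two contributions equal. -/
lemma IsFeasible.l1Norm_sub {σ : Fin n → Fin k} (hσ : IsBalanced σ) (hk : 0 < k)
    (hY : IsFeasible k Y) : l1Norm (Y - clusterMatrix σ) = 2 * offDiagMass σ Y := by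
  have h1 : ∀ i j, |(Y - clusterMatrix σ) i j| =
      Y i j + clusterMatrix σ i j - 2 * (Y i j * clusterMatrix σ i j) := by
    intro i j
    have h0 := hY.nonneg i j
    have h1 := hY.le_one i j
    by_cases h : σ i = σ j
    · simp only [Matrix.sub_apply, clusterMatrix, Matrix.of_apply, h, if_true]
      rw [abs_of_nonpos (by linarith)]; ring
    · simp [clusterMatrix, h, abs_of_nonneg h0]
  rw [offDiagMass_eq_sub]
  simp only [l1Norm, h1, Finset.sum_sub_distrib, Finset.sum_add_distrib, hY.row_sum,
    sum_clusterMatrix hσ hk, ← Finset.mul_sum]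
  ring

end Feasible

/-! ### Noise Gram matrix and the basic inequality. -/

section Gram

variable {n k d : ℕ} {σ : Fin n → Fin k} {Y : Matrix (Fin n) (Fin n) ℝ}

/-- An operator and its adjoint have the same norm: test the quadratic form at the combination
itself and apply Cauchy–Schwarz. -/
lemma norm_sum_smul_sq_le {E : Type*} [NormedAddCommGroup E] [InnerProductSpace ℝ E]
    {g : Fin n → E} {K : ℝ} (hK0 : 0 ≤ K)
    (hK : ∀ u : E, ∑ i, (inner ℝ (g i) u) ^ 2 ≤ K * ‖u‖ ^ 2)
    (c : Fin n → ℝ) : ‖∑ i, c i • g i‖ ^ 2 ≤ K * ∑ i, c i ^ 2 := by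
  set w := ∑ i, c i • g i with hw
  have h1 : ‖w‖ ^ 2 = ∑ i, c i * inner ℝ (g i) w := by
    rw [← real_inner_self_eq_norm_sq]
    conv_lhs => rw [hw, sum_inner]
    exact Finset.sum_congr rfl fun i _ => by rw [real_inner_smul_left]
  have h2 := Finset.sum_mul_sq_le_sq_mul_sq Finset.univ c fun i => inner ℝ (g i) w
  rw [← h1] at h2
  have hc : 0 ≤ ∑ i, c i ^ 2 := Finset.sum_nonneg fun i _ => sq_nonneg _
  have h3 : (‖w‖ ^ 2) ^ 2 ≤ (K * ∑ i, c i ^ 2) * ‖w‖ ^ 2 := by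
    refine h2.trans ((mul_le_mul_of_nonneg_left (hK w) hc).trans (le_of_eq (by ring)))
  by_cases hw0 : ‖w‖ ^ 2 = 0
  · rw [hw0]
    exact mul_nonneg hK0 hc
  · have : 0 < ‖w‖ ^ 2 := lt_of_le_of_ne (sq_nonneg _) (Ne.symm hw0)
    rw [sq] at h3
    exact le_of_mul_le_mul_right h3 this

lemma sum_sum_eq_of_decomp {E : Type*} [NormedAddCommGroup E] [InnerProductSpace ℝ E] {m : ℕ}
    {v : Fin m → Fin n → ℝ} (hv : ∀ i j, Y i j = ∑ l, v l i * v l j) (x : Fin n → E) :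
    ∑ i, ∑ j, Y i j * inner ℝ (x i) (x j) = ∑ l, ‖∑ i, v l i • x i‖ ^ 2 := by
  have h : ∀ l, ‖∑ i, v l i • x i‖ ^ 2 =
      ∑ i, ∑ j, v l i * v l j * inner ℝ (x i) (x j) := by
    intro l
    rw [← real_inner_self_eq_norm_sq, sum_inner]
    refine Finset.sum_congr rfl fun i _ => ?_
    rw [inner_sum]
    refine Finset.sum_congr rfl fun j _ => ?_
    rw [real_inner_smul_left, real_inner_smul_right]; ring
  simp only [h]
  conv_rhs => rw [Finset.sum_comm]
  refine Finset.sum_congr rfl fun i _ => ?_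
  conv_rhs => rw [Finset.sum_comm]
  refine Finset.sum_congr rfl fun j _ => ?_
  rw [hv, Finset.sum_mul]

/-- The Gram matrix of the noise, after removal of the cluster means, has a small inner product with
each feasible matrix. -/
lemma IsFeasible.sum_inner_sub_clusterMean_le {E : Type*} [NormedAddCommGroup E]
    [InnerProductSpace ℝ E] (hσ : IsBalanced σ) (hk : 0 < k) (hn : 0 < n) (hY : IsFeasible k Y)
    {g : Fin n → E} {K : ℝ} (hK0 : 0 ≤ K)
    (hK : ∀ u : E, ∑ i, (inner ℝ (g i) u) ^ 2 ≤ K * ‖u‖ ^ 2) :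
    ∑ i, ∑ j, Y i j * inner ℝ (g i - clusterMean σ g i) (g j - clusterMean σ g j) ≤
      K * (((n : ℝ) / k)⁻¹ * offDiagMass σ Y) := by
  obtain ⟨m, v, hv⟩ := hY.exists_sum_mul
  rw [sum_sum_eq_of_decomp hv]
  have h1 : ∀ l, ‖∑ i, v l i • (g i - clusterMean σ g i)‖ ^ 2 ≤
      K * (∑ i, v l i ^ 2 - ∑ i, v l i * clusterMean σ (v l) i) := by
    intro l
    -- Self-adjointness moves the centering from the noise to the factor of Y, where it is small if
    -- Y is close to block-constant.
    rw [sum_smul_sub_clusterMean, ← sum_sub_clusterMean_sq hσ hk hn]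
    exact norm_sum_smul_sq_le hK0 hK _
  refine (Finset.sum_le_sum fun l _ => h1 l).trans (le_of_eq ?_)
  rw [← Finset.mul_sum, Finset.sum_sub_distrib]
  congr 1
  have h2 : ∑ l, ∑ i, v l i ^ 2 = n := by
    rw [Finset.sum_comm]
    have : ∀ i, ∑ l, v l i ^ 2 = 1 := fun i => by
      rw [← hY.diag i, hv]; exact Finset.sum_congr rfl fun l _ => by ring
    simp [this]
  have h3 : ∑ l, ∑ i, v l i * clusterMean σ (v l) i =
      ((n : ℝ) / k)⁻¹ * ∑ i, ∑ j, Y i j * clusterMatrix σ i j := by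
    rw [Finset.sum_comm, Finset.mul_sum]
    refine Finset.sum_congr rfl fun i _ => ?_
    simp only [clusterMean, smul_eq_mul, hv, Finset.mul_sum, Finset.sum_mul]
    rw [Finset.sum_comm]
    exact Finset.sum_congr rfl fun j _ => Finset.sum_congr rfl fun l _ => by ring
  have hk' : (k : ℝ) ≠ 0 := by positivity
  have hn' : (n : ℝ) ≠ 0 := by positivity
  -- The trace n is also (n/k)⁻¹ times the total sum of Y, so the difference is exactly the
  -- off-block mass.
  rw [h2, h3, offDiagMass_eq_sub]
  simp only [hY.row_sum]
  simp only [Finset.sum_const, Finset.card_univ, Fintype.card_fin, nsmul_eq_mul]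
  field_simp

lemma norm_clusterMean_sq_le {E : Type*} [NormedAddCommGroup E]
    [InnerProductSpace ℝ E] (hσ : IsBalanced σ) (hk : 0 < k) (hn : 0 < n)
    {g : Fin n → E} {K : ℝ} (hK0 : 0 ≤ K)
    (hK : ∀ u : E, ∑ i, (inner ℝ (g i) u) ^ 2 ≤ K * ‖u‖ ^ 2) (i : Fin n) :
    ‖clusterMean σ g i‖ ^ 2 ≤ K * ((n : ℝ) / k)⁻¹ := by
  have h1 : ∀ j, clusterMatrix σ i j ^ 2 = clusterMatrix σ i j := fun j => by
    simp only [clusterMatrix, Matrix.of_apply]; split_ifs <;> norm_num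
  have h2 := norm_sum_smul_sq_le hK0 hK (clusterMatrix σ i)
  simp only [h1, sum_clusterMatrix hσ hk] at h2
  have hm : (0 : ℝ) < (n : ℝ) / k := by positivity
  rw [clusterMean, norm_smul, mul_pow, Real.norm_eq_abs, sq_abs]
  refine (mul_le_mul_of_nonneg_left h2 (by positivity)).trans (le_of_eq ?_)
  field_simp

/-- A Young-type lower bound for one pair of clusters. -/
lemma pair_bound {E : Type*} [NormedAddCommGroup E] [InnerProductSpace ℝ E] {δ p q w : E}
    {κ X : ℝ} (hp : ‖p‖ ^ 2 ≤ κ) (hq : ‖q‖ ^ 2 ≤ κ) (hκ : 1000 * κ ≤ ‖δ‖ ^ 2)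
    (hw : inner ℝ (p - q) w ≤ ‖δ‖ ^ 2 / 32) (hX : 2 * inner ℝ δ w - ‖δ‖ ^ 2 / 8 ≤ X) :
    ‖δ‖ ^ 2 / 8 - X ≤
      ‖δ + (p - q)‖ ^ 2 / 2 - 2 * inner ℝ (δ + (p - q)) (w - q) - κ := by
  have hη : ‖p - q‖ ^ 2 ≤ 4 * κ := by
    have := parallelogram_law_with_norm ℝ p q
    nlinarith [sq_nonneg ‖p + q‖]
  have e1 : ‖δ + (p - q)‖ ^ 2 = ‖δ‖ ^ 2 + 2 * inner ℝ δ (p - q) + ‖p - q‖ ^ 2 :=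
    norm_add_sq_real _ _
  have e2 : inner ℝ (δ + (p - q)) (w - q) =
      inner ℝ δ w - inner ℝ δ q + inner ℝ (p - q) w - inner ℝ (p - q) q := by
    rw [inner_add_left, inner_sub_right, inner_sub_right]; ring
  have i1 := abs_le.1 (abs_real_inner_le_norm δ (p - q))
  have i2 := abs_le.1 (abs_real_inner_le_norm δ q)
  have i3 := abs_le.1 (abs_real_inner_le_norm (p - q) q)
  have j1 : ‖δ‖ * ‖p - q‖ ≤ ‖δ‖ ^ 2 / 16 + 16 * κ := by
    nlinarith [sq_nonneg (‖δ‖ - 8 * ‖p - q‖)]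
  have j2 : ‖δ‖ * ‖q‖ ≤ ‖δ‖ ^ 2 / 32 + 8 * κ := by
    nlinarith [sq_nonneg (‖δ‖ - 16 * ‖q‖)]
  have j3 : ‖p - q‖ * ‖q‖ ≤ 5 / 2 * κ := by
    nlinarith [sq_nonneg (‖p - q‖ - ‖q‖)]
  rw [e1, e2]
  -- Of ‖δ‖²/2, the errors use 1/16 + 1/8 + 1/16 + 1/16, leaving 3/16; the remaining 38κ is below
  -- ‖δ‖²/16 by `hκ`.
  nlinarith [sq_nonneg ‖p - q‖]

lemma trace_transpose_mul_distMatrix (Y : Matrix (Fin n) (Fin n) ℝ)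
    (h : Fin n → EuclideanSpace ℝ (Fin d)) :
    (Y.transpose * distMatrix h).trace = ∑ i, ∑ j, Y i j * ‖h i - h j‖ ^ 2 := by
  simp only [Matrix.trace, Matrix.diag, Matrix.mul_apply, Matrix.transpose_apply, distMatrix,
    Matrix.of_apply]
  exact Finset.sum_comm

/-- The fixed row sums make the first term on the right independent of Y, so it cancels when two
feasible matrices are compared. -/
lemma IsFeasible.sum_mul_norm_sub_sq {E : Type*} [NormedAddCommGroup E]
    [InnerProductSpace ℝ E] (hY : IsFeasible k Y) (x : Fin n → E) :
    ∑ i, ∑ j, Y i j * ‖x i - x j‖ ^ 2 =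
      2 * ((n : ℝ) / k) * ∑ i, ‖x i‖ ^ 2 - 2 * ∑ i, ∑ j, Y i j * inner ℝ (x i) (x j) := by
  have h1 : ∀ i j, Y i j * ‖x i - x j‖ ^ 2 =
      Y i j * ‖x i‖ ^ 2 - 2 * (Y i j * inner ℝ (x i) (x j)) + Y j i * ‖x j‖ ^ 2 := by
    intro i j
    rw [norm_sub_sq_real, hY.symm_apply j i]; ring
  have h2 : ∑ i, ∑ j, Y i j * ‖x i‖ ^ 2 = (n : ℝ) / k * ∑ i, ‖x i‖ ^ 2 := by
    simp only [← Finset.sum_mul, hY.row_sum, Finset.mul_sum]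
  have h3 : ∑ i, ∑ j, Y j i * ‖x j‖ ^ 2 = (n : ℝ) / k * ∑ i, ‖x i‖ ^ 2 := by
    rw [Finset.sum_comm, h2]
  simp only [h1, Finset.sum_add_distrib, Finset.sum_sub_distrib, h2, h3, ← Finset.mul_sum]
  ring

/-- Symmetry of Y folds the cross term onto x j alone, so later bounds involve one noise vector per
column. -/
lemma IsFeasible.sum_mul_norm_add_sub_add_sq {E : Type*} [NormedAddCommGroup E]
    [InnerProductSpace ℝ E] (hY : IsFeasible k Y) (c x : Fin n → E) :
    ∑ i, ∑ j, Y i j * ‖(c i + x i) - (c j + x j)‖ ^ 2 =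
      2 * ∑ i, ∑ j, Y i j * (‖c i - c j‖ ^ 2 / 2 - 2 * inner ℝ (c i - c j) (x j)) +
        ∑ i, ∑ j, Y i j * ‖x i - x j‖ ^ 2 := by
  have h1 : ∀ i j, Y i j * ‖(c i + x i) - (c j + x j)‖ ^ 2 =
      Y i j * (‖c i - c j‖ ^ 2 / 2 - 2 * inner ℝ (c i - c j) (x j)) +
      Y j i * (‖c j - c i‖ ^ 2 / 2 - 2 * inner ℝ (c j - c i) (x i)) +
      Y i j * ‖x i - x j‖ ^ 2 := by
    intro i j
    rw [add_sub_add_comm, norm_add_sq_real, hY.symm_apply j i, norm_sub_rev (c j) (c i),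
      ← neg_sub (c i) (c j), inner_neg_left, inner_sub_right]
    ring
  have h2 := Finset.sum_comm (s := Finset.univ) (t := Finset.univ) (f := fun i j : Fin n =>
    Y j i * (‖c j - c i‖ ^ 2 / 2 - 2 * inner ℝ (c j - c i) (x i)))
  simp only [h1, Finset.sum_add_distrib]
  rw [h2]
  ring

/-- The basic inequality: on the event that the noise is well behaved, the weight which a solution
of the semidefinite program puts on wrong pairs is controlled by the pointwise noise levels. -/
theorem IsSDPSolution.offDiagMass_le (hσ : IsBalanced σ) (hk : 0 < k) (hn : 0 < n)
    {μ : Fin k → EuclideanSpace ℝ (Fin d)} {g : Fin n → EuclideanSpace ℝ (Fin d)}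
    (hY : IsSDPSolution k (distMatrix (dataPoint μ σ g)) Y) {K Δ : ℝ} (hK0 : 0 ≤ K)
    (hK : ∀ u, ∑ i, (inner ℝ (g i) u) ^ 2 ≤ K * ‖u‖ ^ 2)
    (hKμ : ∀ a b, a ≠ b → 1000 * (K * ((n : ℝ) / k)⁻¹) ≤ ‖μ a - μ b‖ ^ 2)
    (hΔ : ∀ a b, a ≠ b → Δ ≤ ‖μ a - μ b‖ ^ 2)
    (hmean : ∀ i j, σ i ≠ σ j → inner ℝ (clusterMean σ g i - clusterMean σ g j) (g j) ≤
      ‖μ (σ i) - μ (σ j)‖ ^ 2 / 32)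
    {X : Fin n → ℝ} (hX0 : ∀ j, 0 ≤ X j)
    (hX : ∀ i j, σ i ≠ σ j → 2 * inner ℝ (μ (σ i) - μ (σ j)) (g j) -
      ‖μ (σ i) - μ (σ j)‖ ^ 2 / 8 ≤ X j) :
    Δ / 8 * offDiagMass σ Y ≤ (n : ℝ) / k * ∑ j, X j := by
  obtain ⟨hF, hopt⟩ := hY
  have hF' := isFeasible_clusterMatrix hσ hk
  set κ := K * ((n : ℝ) / k)⁻¹ with hκ
  set x : Fin n → EuclideanSpace ℝ (Fin d) := fun i => g i - clusterMean σ g i with hx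
  set c : Fin n → EuclideanSpace ℝ (Fin d) := fun i => μ (σ i) + clusterMean σ g i with hc
  have hh : dataPoint μ σ g = fun i => c i + x i := by
    ext1 i; simp only [dataPoint, hc, hx]; abel
  have hopt' := hopt _ hF'
  rw [trace_transpose_mul_distMatrix, trace_transpose_mul_distMatrix, hh,
    hF.sum_mul_norm_add_sub_add_sq, hF'.sum_mul_norm_add_sub_add_sq, hF.sum_mul_norm_sub_sq,
    hF'.sum_mul_norm_sub_sq] at hopt'
  have hcc : ∀ i j, σ i = σ j → c i = c j := fun i j h => by
    simp only [hc, h, clusterMean_congr g h]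
  -- For the cluster matrix the signal part vanishes, and its Gram term can be dropped by sign.
  have hstar1 : ∑ i, ∑ j, clusterMatrix σ i j *
      (‖c i - c j‖ ^ 2 / 2 - 2 * inner ℝ (c i - c j) (x j)) = 0 := by
    refine Finset.sum_eq_zero fun i _ => Finset.sum_eq_zero fun j _ => ?_
    by_cases h : σ i = σ j
    · simp [hcc i j h]
    · simp [clusterMatrix, h]
  have hstar2 : 0 ≤ ∑ i, ∑ j, clusterMatrix σ i j * inner ℝ (x i) (x j) := by
    obtain ⟨m, v, hv⟩ := hF'.exists_sum_mul
    rw [sum_sum_eq_of_decomp hv]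
    exact Finset.sum_nonneg fun l _ => sq_nonneg _
  have hgram := hF.sum_inner_sub_clusterMean_le hσ hk hn hK0 hK
  have hterm : ∀ i j, (if σ i = σ j then 0 else Y i j) * (Δ / 8) - Y i j * X j ≤
      Y i j * (‖c i - c j‖ ^ 2 / 2 - 2 * inner ℝ (c i - c j) (x j)) -
        κ * (if σ i = σ j then 0 else Y i j) := by
    intro i j
    have hYij := hF.nonneg i j
    by_cases h : σ i = σ j
    · simpa [h, hcc i j h] using mul_nonneg hYij (hX0 j)
    · have hsub : c i - c j =
          (μ (σ i) - μ (σ j)) + (clusterMean σ g i - clusterMean σ g j) := by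
        simp only [hc]; abel
      have hpb := pair_bound (norm_clusterMean_sq_le hσ hk hn hK0 hK i)
        (norm_clusterMean_sq_le hσ hk hn hK0 hK j) (hKμ _ _ h) (hmean i j h) (hX i j h)
      rw [← hsub] at hpb
      have hpb' : Δ / 8 - X j + κ ≤
          ‖c i - c j‖ ^ 2 / 2 - 2 * inner ℝ (c i - c j) (x j) := by
        have := hΔ _ _ h
        simp only [hx]
        linarith
      have := mul_le_mul_of_nonneg_left hpb' hYij
      simp only [h, if_false]
      linarith
  have hsum := Finset.sum_le_sum fun i (_ : i ∈ Finset.univ) =>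
    Finset.sum_le_sum fun j (_ : j ∈ Finset.univ) => hterm i j
  simp only [Finset.sum_sub_distrib, ← Finset.sum_mul, ← Finset.mul_sum] at hsum
  -- Levels depending on j only are summed through the column sums of Y.
  have hXsum : ∑ i, ∑ j, Y i j * X j = (n : ℝ) / k * ∑ j, X j := by
    rw [Finset.sum_comm, Finset.mul_sum]
    refine Finset.sum_congr rfl fun j _ => ?_
    simp only [← Finset.sum_mul, ← hF.row_sum j, hF.symm_apply j]
  rw [hXsum] at hsum
  change offDiagMass σ Y * (Δ / 8) - _ ≤ _ - κ * offDiagMass σ Y at hsum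
  rw [← mul_assoc] at hgram
  change _ ≤ κ * offDiagMass σ Y at hgram
  rw [hstar1] at hopt'
  linarith

end Gram

/-! ### Sub-Gaussian random variables and vectors -/

lemma exp_le_add_exp_sq (x : ℝ) : Real.exp x ≤ x + Real.exp (x ^ 2) := by
  have h2 := Real.add_one_le_exp (x ^ 2)
  by_cases h : |x| ≤ 1
  · have := (abs_le.1 (Real.abs_exp_sub_one_sub_id_le h)).2
    linarith
  · rcases lt_or_ge 0 x with hx | hx
    · rw [abs_of_pos hx] at h
      have : Real.exp x ≤ Real.exp (x ^ 2) := Real.exp_le_exp.2 (by nlinarith)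
      linarith
    · have : Real.exp x ≤ 1 := Real.exp_le_one_iff.2 hx
      rw [abs_of_nonpos hx] at h
      nlinarith

lemma exp_mul_le_one_add {a : ℝ} (ha0 : 0 ≤ a) (ha1 : a ≤ 1) (y : ℝ) :
    Real.exp (a * y) ≤ 1 + a * (Real.exp y - 1) := by
  have := convexOn_exp.2 (Set.mem_univ 0) (Set.mem_univ y) (sub_nonneg.2 ha1) ha0 (by ring)
  simp only [smul_eq_mul, mul_zero, zero_add, Real.exp_zero] at this
  linarith

section Scalar

variable {Ω : Type u} [MeasurableSpace Ω] {P : Measure Ω}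

lemma lintegral_exp_sq_le_of_psi2Norm_lt {X : Ω → ℝ} {s : ℝ}
    (h : psi2Norm P X < ENNReal.ofReal s) :
    ∫⁻ ω, ENNReal.ofReal (Real.exp (X ω ^ 2 / s ^ 2)) ∂P ≤ 2 := by
  simp only [psi2Norm, iInf_lt_iff] at h
  obtain ⟨t, ht, hint, hts⟩ := h
  have hts' : t ≤ s := ((ENNReal.ofReal_lt_ofReal_iff_of_nonneg ht.le).1 hts).le
  refine (lintegral_mono fun ω => ENNReal.ofReal_le_ofReal (Real.exp_le_exp.2 ?_)).trans hint
  gcongr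

lemma integrable_exp_sq {X : Ω → ℝ} {t : ℝ} (hX : Measurable X)
    (h : ∫⁻ ω, ENNReal.ofReal (Real.exp (X ω ^ 2 / t ^ 2)) ∂P ≤ 2) :
    Integrable (fun ω => Real.exp (X ω ^ 2 / t ^ 2)) P := by
  refine ⟨by fun_prop, ?_⟩
  rw [hasFiniteIntegral_iff_ofReal (Filter.Eventually.of_forall fun ω => (Real.exp_pos _).le)]
  exact h.trans_lt (by simp)

lemma integral_exp_sq_le {X : Ω → ℝ} {t : ℝ} (hX : Measurable X)
    (h : ∫⁻ ω, ENNReal.ofReal (Real.exp (X ω ^ 2 / t ^ 2)) ∂P ≤ 2) :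
    ∫ ω, Real.exp (X ω ^ 2 / t ^ 2) ∂P ≤ 2 := by
  rw [integral_eq_lintegral_of_nonneg_ae (Filter.Eventually.of_forall fun ω => (Real.exp_pos _).le)
    (by fun_prop)]
  exact ENNReal.toReal_le_of_le_ofReal (by norm_num) (by simpa using h)

lemma integrable_of_exp_sq {X : Ω → ℝ} {t : ℝ} (ht : 0 < t) (hX : Measurable X)
    (h : ∫⁻ ω, ENNReal.ofReal (Real.exp (X ω ^ 2 / t ^ 2)) ∂P ≤ 2) : Integrable X P := by
  refine ((integrable_exp_sq hX h).const_mul t).mono' (by fun_prop)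
    (Filter.Eventually.of_forall fun ω => ?_)
  have h1 := Real.add_one_le_exp (X ω ^ 2 / t ^ 2)
  have h2 : |X ω| / t ≤ X ω ^ 2 / t ^ 2 + 1 := by
    rw [← sq_abs, ← div_pow]; nlinarith [sq_nonneg (|X ω| / t - 1)]
  rw [Real.norm_eq_abs]
  have h3 := h2.trans h1
  rw [div_le_iff₀ ht] at h3
  linarith

variable [IsProbabilityMeasure P]

/-- A centered random variable with finite sub-Gaussian norm has a sub-Gaussian moment generating
function. -/
lemma hasSubgaussianMGF_of_exp_sq {X : Ω → ℝ} {t : ℝ} (ht : 0 < t) (hX : Measurable X)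
    (h : ∫⁻ ω, ENNReal.ofReal (Real.exp (X ω ^ 2 / t ^ 2)) ∂P ≤ 2) (h0 : ∫ ω, X ω ∂P = 0) :
    HasSubgaussianMGF X (Real.toNNReal (2 * t ^ 2)) P := by
  have hI := integrable_exp_sq hX h
  have hle := integral_exp_sq_le hX h
  have hXI := integrable_of_exp_sq ht hX h
  have hexp : ∀ s : ℝ, Integrable (fun ω => Real.exp (s * X ω)) P := by
    intro s
    refine (hI.const_mul (Real.exp (s ^ 2 * t ^ 2))).mono' (by fun_prop)
      (Filter.Eventually.of_forall fun ω => ?_)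
    rw [Real.norm_eq_abs, abs_of_pos (Real.exp_pos _), ← Real.exp_add]
    refine Real.exp_le_exp.2 ?_
    have : s * X ω = (s * t) * (X ω / t) := by field_simp
    rw [this, ← div_pow, ← mul_pow]
    nlinarith [sq_nonneg (s * t - X ω / t), sq_nonneg (s * t), sq_nonneg (X ω / t)]
  refine ⟨hexp, fun s => ?_⟩
  rw [Real.coe_toNNReal _ (by positivity)]
  set a := s ^ 2 * t ^ 2 with ha
  have ha0 : 0 ≤ a := by positivity
  have hgoal : 2 * t ^ 2 * s ^ 2 / 2 = a := by rw [ha]; ring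
  rw [hgoal, mgf]
  -- For small a the centering removes the linear term of the exponential. For large a the
  -- inequality s X ≤ a/2 + X²/(2t²) suffices.
  rcases le_or_gt a 1 with ha1 | ha1
  · have hpt : ∀ ω, Real.exp (s * X ω) ≤
        s * X ω + (1 + a * (Real.exp (X ω ^ 2 / t ^ 2) - 1)) := by
      intro ω
      have h1 := exp_le_add_exp_sq (s * X ω)
      have h2 := exp_mul_le_one_add ha0 ha1 (X ω ^ 2 / t ^ 2)
      have : (s * X ω) ^ 2 = a * (X ω ^ 2 / t ^ 2) := by rw [ha]; field_simp
      rw [this] at h1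
      linarith
    have hI2 : Integrable (fun ω => a * (Real.exp (X ω ^ 2 / t ^ 2) - 1)) P :=
      (hI.sub (integrable_const 1)).const_mul a
    have hI3 : Integrable (fun ω => 1 + a * (Real.exp (X ω ^ 2 / t ^ 2) - 1)) P :=
      (integrable_const 1).add hI2
    calc ∫ ω, Real.exp (s * X ω) ∂P
        ≤ ∫ ω, s * X ω + (1 + a * (Real.exp (X ω ^ 2 / t ^ 2) - 1)) ∂P :=
          integral_mono (hexp s) ((hXI.const_mul s).add hI3) hpt
      _ = 1 + a * (∫ ω, Real.exp (X ω ^ 2 / t ^ 2) ∂P - 1) := by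
          rw [integral_add (hXI.const_mul s) hI3,
            integral_add (integrable_const 1) hI2, integral_const_mul, integral_const_mul,
            integral_sub hI (integrable_const 1), h0]
          simp
      _ ≤ 1 + a * (2 - 1) := by gcongr
      _ ≤ Real.exp a := by linarith [Real.add_one_le_exp a]
  · have hpt : ∀ ω, Real.exp (s * X ω) ≤
        Real.exp (a / 2) * (1 + 1 / 2 * (Real.exp (X ω ^ 2 / t ^ 2) - 1)) := by
      intro ω
      have h2 := exp_mul_le_one_add (by norm_num : (0 : ℝ) ≤ 1 / 2) (by norm_num)
        (X ω ^ 2 / t ^ 2)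
      refine le_trans ?_ (mul_le_mul_of_nonneg_left h2 (Real.exp_pos _).le)
      rw [← Real.exp_add]
      refine Real.exp_le_exp.2 ?_
      have : s * X ω = (s * t) * (X ω / t) := by field_simp
      rw [this, ha, ← div_pow, ← mul_pow]
      nlinarith [sq_nonneg (s * t - X ω / t)]
    have hI2 : Integrable (fun ω => 1 / 2 * (Real.exp (X ω ^ 2 / t ^ 2) - 1)) P :=
      (hI.sub (integrable_const 1)).const_mul _
    calc ∫ ω, Real.exp (s * X ω) ∂P
        ≤ ∫ ω, Real.exp (a / 2) * (1 + 1 / 2 * (Real.exp (X ω ^ 2 / t ^ 2) - 1)) ∂P :=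
          integral_mono (hexp s) (((integrable_const 1).add hI2).const_mul _) hpt
      _ = Real.exp (a / 2) * (1 + 1 / 2 * (∫ ω, Real.exp (X ω ^ 2 / t ^ 2) ∂P - 1)) := by
          rw [integral_const_mul, integral_add (integrable_const 1) hI2, integral_const_mul,
            integral_sub hI (integrable_const 1)]
          simp
      _ ≤ Real.exp (a / 2) * (1 + 1 / 2 * (2 - 1)) := by gcongr
      _ ≤ Real.exp (a / 2) * Real.exp (a / 2) := by
          gcongr
          linarith [Real.add_one_le_exp (a / 2)]
      _ = Real.exp a := by rw [← Real.exp_add]; ring_nf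

end Scalar

section Vector

variable {Ω : Type u} [MeasurableSpace Ω] {P : Measure Ω} [IsProbabilityMeasure P] {d : ℕ}

/-- The factor 2 in front of τ gives strict room above the infimum defining the norm, so its
attainment need not be discussed. -/
lemma lintegral_exp_inner_sq_le {x : Ω → EuclideanSpace ℝ (Fin d)} {τ : ℝ} (hτ : 0 < τ)
    (h : vecPsi2Norm P x ≤ ENNReal.ofReal τ) {v : EuclideanSpace ℝ (Fin d)} {R : ℝ}
    (hv : ‖v‖ ≤ R) :
    ∫⁻ ω, ENNReal.ofReal (Real.exp ((inner ℝ (x ω) v : ℝ) ^ 2 / (2 * τ * R) ^ 2)) ∂P ≤ 2 := by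
  by_cases hv0 : v = 0
  · subst hv0
    simp
  have hvpos : 0 < ‖v‖ := norm_pos_iff.2 hv0
  have hu : ‖‖v‖⁻¹ • v‖ = 1 := norm_smul_inv_norm (𝕜 := ℝ) hv0
  have h1 : psi2Norm P (fun ω => inner ℝ (x ω) (‖v‖⁻¹ • v)) < ENNReal.ofReal (2 * τ) := by
    refine lt_of_le_of_lt (le_trans ?_ h)
      ((ENNReal.ofReal_lt_ofReal_iff (by positivity)).2 (by linarith))
    exact le_iSup₂ (f := fun (v : EuclideanSpace ℝ (Fin d)) (_ : ‖v‖ = 1) =>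
      psi2Norm P (fun ω => inner ℝ (x ω) v)) _ hu
  refine (lintegral_mono fun ω => ENNReal.ofReal_le_ofReal (Real.exp_le_exp.2 ?_)).trans
    (lintegral_exp_sq_le_of_psi2Norm_lt h1)
  have h2 : (inner ℝ (x ω) (‖v‖⁻¹ • v) : ℝ) ^ 2 / (2 * τ) ^ 2 =
      (inner ℝ (x ω) v : ℝ) ^ 2 / (2 * τ * ‖v‖) ^ 2 := by
    rw [real_inner_smul_right]; field_simp
  rw [h2]
  gcongr

lemma integrable_of_vecPsi2Norm_le {x : Ω → EuclideanSpace ℝ (Fin d)} {τ : ℝ} (hτ : 0 < τ)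
    (hx : Measurable x) (h : vecPsi2Norm P x ≤ ENNReal.ofReal τ) : Integrable x P := by
  refine Integrable.of_eval_piLp fun i => ?_
  have h1 := lintegral_exp_inner_sq_le hτ h (v := EuclideanSpace.single i 1) (R := 1) (by simp)
  have := integrable_of_exp_sq (by positivity) (by fun_prop) h1
  simpa [EuclideanSpace.inner_single_right] using this

lemma hasSubgaussianMGF_inner {x : Ω → EuclideanSpace ℝ (Fin d)} {τ : ℝ} (hτ : 0 < τ)
    (hx : Measurable x) (h : vecPsi2Norm P x ≤ ENNReal.ofReal τ) (h0 : ∫ ω, x ω ∂P = 0)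
    {v : EuclideanSpace ℝ (Fin d)} {R : ℝ} (hR : 0 < R) (hv : ‖v‖ ≤ R) :
    HasSubgaussianMGF (fun ω => (inner ℝ (x ω) v : ℝ)) (Real.toNNReal (8 * τ ^ 2 * R ^ 2)) P := by
  have h1 : 8 * τ ^ 2 * R ^ 2 = 2 * (2 * τ * R) ^ 2 := by ring
  rw [h1]
  refine hasSubgaussianMGF_of_exp_sq (by positivity) (by fun_prop)
    (lintegral_exp_inner_sq_le hτ h hv) ?_
  have := integral_inner (𝕜 := ℝ) (integrable_of_vecPsi2Norm_le hτ hx h) v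
  rw [h0, inner_zero_right] at this
  rw [← this]
  exact integral_congr_ae (Filter.Eventually.of_forall fun ω => real_inner_comm _ _)

end Vector

/-! ### Nets and quadratic forms -/

/-- A 1-separated set in the ball of radius 2 has at most 5^d points, by volume. One that cannot be
enlarged is a net, and it is then scaled by 1/2. -/
lemma exists_net (d : ℕ) : ∃ N : Finset (EuclideanSpace ℝ (Fin d)), N.card ≤ 5 ^ d ∧
    (∀ y ∈ N, ‖y‖ ≤ 1) ∧ ∀ x, ‖x‖ ≤ 1 → ∃ y ∈ N, ‖x - y‖ ≤ 1 / 2 := by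
  classical
  let Sep : Finset (EuclideanSpace ℝ (Fin d)) → Prop := fun s =>
    (∀ c ∈ s, ‖c‖ ≤ 2) ∧ ∀ c ∈ s, ∀ e ∈ s, c ≠ e → 1 ≤ ‖c - e‖
  have hbound : ∀ s, Sep s → s.card ≤ 5 ^ d := fun s hs => by
    simpa using Besicovitch.card_le_of_separated s hs.1 hs.2
  obtain ⟨s, hs, hnet⟩ : ∃ s, Sep s ∧ ∀ x, ‖x‖ ≤ 2 → ∃ y ∈ s, ‖x - y‖ < 1 := by
    by_contra! hcon
    have : ∀ m : ℕ, ∃ s, Sep s ∧ s.card = m := by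
      intro m
      induction m with
      | zero => exact ⟨∅, by simp [Sep], rfl⟩
      | succ m ih =>
        obtain ⟨s, hs, hm⟩ := ih
        obtain ⟨x, hx, hxs⟩ := hcon s hs
        have hxn : x ∉ s := fun h => by
          have := hxs x h
          norm_num at this
        refine ⟨insert x s, ⟨?_, ?_⟩, by rw [Finset.card_insert_of_notMem hxn, hm]⟩
        · intro c hc
          rcases Finset.mem_insert.1 hc with rfl | hc
          · exact hx
          · exact hs.1 c hc
        · intro c hc e he hce
          rcases Finset.mem_insert.1 hc with rfl | hc'
          · rcases Finset.mem_insert.1 he with rfl | he'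
            · exact absurd rfl hce
            · exact hxs e he'
          · rcases Finset.mem_insert.1 he with rfl | he'
            · rw [norm_sub_rev]; exact hxs c hc'
            · exact hs.2 c hc' e he' hce
    obtain ⟨s, hs, hm⟩ := this (5 ^ d + 1)
    have := hbound s hs
    omega
  refine ⟨s.image fun y => (1 / 2 : ℝ) • y, Finset.card_image_le.trans (hbound s hs), ?_, ?_⟩
  · intro y hy
    obtain ⟨z, hz, rfl⟩ := Finset.mem_image.1 hy
    have := hs.1 z hz
    rw [norm_smul]; norm_num; linarith
  · intro x hx
    obtain ⟨y, hy, hxy⟩ := hnet ((2 : ℝ) • x) (by rw [norm_smul]; norm_num; linarith)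
    refine ⟨_, Finset.mem_image_of_mem _ hy, ?_⟩
    have : x - (1 / 2 : ℝ) • y = (1 / 2 : ℝ) • ((2 : ℝ) • x - y) := by
      rw [smul_sub, smul_smul]; norm_num
    rw [this, norm_smul]; norm_num; linarith

/-- A bound for a positive quadratic form on a net of the unit ball extends to the whole space. -/
lemma sum_inner_sq_le_of_net {d : ℕ} {ι : Type*} [Fintype ι] {N : Finset (EuclideanSpace ℝ (Fin d))}
    (hN : ∀ x, ‖x‖ ≤ 1 → ∃ y ∈ N, ‖x - y‖ ≤ 1 / 2) {g : ι → EuclideanSpace ℝ (Fin d)} {B : ℝ}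
    (hB : ∀ y ∈ N, ∑ i, (inner ℝ (g i) y) ^ 2 ≤ B) (u : EuclideanSpace ℝ (Fin d)) :
    ∑ i, (inner ℝ (g i) u) ^ 2 ≤ 4 * B * ‖u‖ ^ 2 := by
  obtain ⟨y₀, hy₀, -⟩ := hN 0 (by simp)
  have hB0 : 0 ≤ B := (Finset.sum_nonneg fun i _ => sq_nonneg _).trans (hB y₀ hy₀)
  let T : EuclideanSpace ℝ (Fin d) →L[ℝ] EuclideanSpace ℝ ι := LinearMap.toContinuousLinearMap
    { toFun := fun u => WithLp.toLp 2 fun i => inner ℝ (g i) u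
      map_add' := fun u v => by ext i; simp [inner_add_right]
      map_smul' := fun c u => by ext i; simp [real_inner_smul_right] }
  have hT : ∀ u, ‖T u‖ ^ 2 = ∑ i, (inner ℝ (g i) u) ^ 2 := fun u => by
    rw [EuclideanSpace.norm_sq_eq]
    refine Finset.sum_congr rfl fun i _ => ?_
    rw [Real.norm_eq_abs, sq_abs]; rfl
  have hunit : ∀ x, ‖x‖ = 1 → ‖T x‖ ≤ Real.sqrt B + ‖T‖ / 2 := by
    intro x hx
    obtain ⟨y, hy, hxy⟩ := hN x hx.le
    have h1 : ‖T y‖ ≤ Real.sqrt B := Real.le_sqrt_of_sq_le (by rw [hT]; exact hB y hy)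
    have h2 : ‖T (x - y)‖ ≤ ‖T‖ * (1 / 2) :=
      (T.le_opNorm _).trans (mul_le_mul_of_nonneg_left hxy (norm_nonneg _))
    have h3 : T x = T y + T (x - y) := by rw [← map_add]; congr 1; abel
    rw [h3]
    linarith [norm_add_le (T y) (T (x - y))]
  -- The net error is half the operator norm, which is absorbed on the left; hence the factor 4
  -- after squaring.
  have hop : ‖T‖ ≤ Real.sqrt B + ‖T‖ / 2 := by
    refine T.opNorm_le_bound (by positivity) fun x => ?_
    by_cases hx : x = 0
    · simp [hx]
    have hx' : 0 < ‖x‖ := norm_pos_iff.2 hx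
    have h1 := hunit (‖x‖⁻¹ • x) (norm_smul_inv_norm (𝕜 := ℝ) hx)
    rw [map_smul, norm_smul, norm_inv, norm_norm, inv_mul_le_iff₀ hx'] at h1
    linarith
  have hop' : ‖T‖ ≤ 2 * Real.sqrt B := by linarith
  rw [← hT]
  calc ‖T u‖ ^ 2 ≤ (2 * Real.sqrt B * ‖u‖) ^ 2 := by
        gcongr
        exact (T.le_opNorm u).trans (by gcongr)
    _ = 4 * B * ‖u‖ ^ 2 := by
        rw [mul_pow, mul_pow, Real.sq_sqrt hB0]; ring

/-! ### High-probability events -/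

section Events

variable {Ω : Type u} [MeasurableSpace Ω] {P : Measure Ω}

/-- The property `Q` holds on a measurable event whose complement has measure at most `c`. -/
def HoldsExcept (P : Measure Ω) (c : ℝ≥0∞) (Q : Ω → Prop) : Prop :=
  ∃ A : Set Ω, MeasurableSet A ∧ P Aᶜ ≤ c ∧ ∀ ω ∈ A, Q ω

lemma HoldsExcept.mono {c c' : ℝ≥0∞} {Q Q' : Ω → Prop} (h : HoldsExcept P c Q) (hc : c ≤ c')
    (hQ : ∀ ω, Q ω → Q' ω) : HoldsExcept P c' Q' := by
  obtain ⟨A, hA, hPA, hAQ⟩ := h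
  exact ⟨A, hA, hPA.trans hc, fun ω hω => hQ ω (hAQ ω hω)⟩

lemma HoldsExcept.and {c c' : ℝ≥0∞} {Q Q' : Ω → Prop} (h : HoldsExcept P c Q)
    (h' : HoldsExcept P c' Q') : HoldsExcept P (c + c') fun ω => Q ω ∧ Q' ω := by
  obtain ⟨A, hA, hPA, hAQ⟩ := h
  obtain ⟨A', hA', hPA', hAQ'⟩ := h'
  refine ⟨A ∩ A', hA.inter hA', ?_, fun ω hω => ⟨hAQ ω hω.1, hAQ' ω hω.2⟩⟩
  rw [Set.compl_inter]
  exact (measure_union_le _ _).trans (add_le_add hPA hPA')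

lemma HoldsExcept.forall_mem {ι : Type*} (s : Finset ι) {c : ℝ≥0∞} {Q : ι → Ω → Prop}
    (h : ∀ i ∈ s, HoldsExcept P c (Q i)) :
    HoldsExcept P (s.card * c) fun ω => ∀ i ∈ s, Q i ω := by
  classical
  induction s using Finset.induction_on with
  | empty => exact ⟨Set.univ, MeasurableSet.univ, by simp, by simp⟩
  | insert i s hi ih =>
    refine ((h i (Finset.mem_insert_self _ _)).and
      (ih fun j hj => h j (Finset.mem_insert_of_mem hj))).mono ?_ ?_
    · rw [Finset.card_insert_of_notMem hi]; push_cast; rw [add_mul, one_mul, add_comm]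
    · rintro ω ⟨h1, h2⟩ j hj
      rcases Finset.mem_insert.1 hj with rfl | hj
      · exact h1
      · exact h2 j hj

lemma HoldsExcept.of_not {c : ℝ≥0∞} {Q : Ω → Prop} (hQ : MeasurableSet {ω | Q ω})
    (h : P {ω | ¬ Q ω} ≤ c) : HoldsExcept P c Q :=
  ⟨{ω | Q ω}, hQ, h, fun _ h => h⟩

lemma HoldsExcept.lt_of_lintegral_le {f : Ω → ℝ≥0∞} (hf : Measurable f) {a b : ℝ≥0∞}
    (ha : a ≠ 0) (ha' : a ≠ ⊤) (h : ∫⁻ ω, f ω ∂P ≤ b) :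
    HoldsExcept P (b / a) fun ω => f ω < a := by
  refine .of_not (measurableSet_lt hf measurable_const) ?_
  simp only [not_lt]
  exact (meas_ge_le_lintegral_div hf.aemeasurable ha ha').trans (ENNReal.div_le_div_right h a)

end Events

/-! ### Quadratic form, norms and inner products of the noise. -/

section Noise

variable {Ω : Type u} [MeasurableSpace Ω] {P : Measure Ω} [IsProbabilityMeasure P] {d : ℕ}

/-- The quadratic form of independent sub-Gaussian vectors is bounded. -/
lemma holdsExcept_sum_inner_sq_le {ι : Type*} [Fintype ι] {g : ι → Ω → EuclideanSpace ℝ (Fin d)}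
    (hg : ∀ i, Measurable (g i)) (hind : iIndepFun g P) {τ : ℝ} (hτ : 0 < τ)
    (hsub : ∀ i, vecPsi2Norm P (g i) ≤ ENNReal.ofReal τ) (T : ℝ) :
    HoldsExcept P (ENNReal.ofReal (5 ^ d * 2 ^ Fintype.card ι * Real.exp (-T)))
      fun ω => ∀ u, ∑ i, (inner ℝ (g i ω) u) ^ 2 ≤ 16 * τ ^ 2 * T * ‖u‖ ^ 2 := by
  obtain ⟨N, hNcard, hN1, hN⟩ := exists_net d
  have key : ∀ y ∈ N, HoldsExcept P (ENNReal.ofReal (2 ^ Fintype.card ι * Real.exp (-T)))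
      fun ω => ∑ i, (inner ℝ (g i ω) y) ^ 2 ≤ 4 * τ ^ 2 * T := by
    intro y hy
    set f : ι → Ω → ℝ≥0∞ := fun i ω =>
      ENNReal.ofReal (Real.exp ((inner ℝ (g i ω) y : ℝ) ^ 2 / (2 * τ * 1) ^ 2)) with hf
    have hfm : ∀ i, Measurable (f i) := fun i => by
      have := hg i
      simp only [hf]; fun_prop
    have hfind : iIndepFun f P := hind.comp (fun _ (x : EuclideanSpace ℝ (Fin d)) =>
      ENNReal.ofReal (Real.exp ((inner ℝ x y : ℝ) ^ 2 / (2 * τ * 1) ^ 2))) fun i => by fun_prop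
    have hint : ∫⁻ ω, ∏ i, f i ω ∂P ≤ 2 ^ Fintype.card ι := by
      rw [lintegral_prod_eq_prod_lintegral_of_indepFun _ f hfind hfm]
      calc ∏ i, ∫⁻ ω, f i ω ∂P ≤ ∏ _i : ι, (2 : ℝ≥0∞) :=
            Finset.prod_le_prod' fun i _ => lintegral_exp_inner_sq_le hτ (hsub i) (hN1 y hy)
        _ = 2 ^ Fintype.card ι := by simp
    refine (HoldsExcept.lt_of_lintegral_le (Finset.measurable_prod _ fun i _ => hfm i)
      (a := ENNReal.ofReal (Real.exp T)) (by simp [Real.exp_pos]) (by simp) hint).mono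
      (le_of_eq ?_) ?_
    · rw [Real.exp_neg, ← div_eq_mul_inv, ENNReal.ofReal_div_of_pos (Real.exp_pos _),
        ENNReal.ofReal_pow (by norm_num)]
      simp
    · intro ω hω
      simp only [hf] at hω
      rw [← ENNReal.ofReal_prod_of_nonneg fun i _ => (Real.exp_pos _).le, ← Real.exp_sum,
        ENNReal.ofReal_lt_ofReal_iff (Real.exp_pos _), Real.exp_lt_exp, ← Finset.sum_div,
        div_lt_iff₀ (by positivity)] at hω
      nlinarith
  refine (HoldsExcept.forall_mem N key).mono ?_ fun ω hω u => ?_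
  · rw [mul_assoc, ENNReal.ofReal_mul (p := (5 : ℝ) ^ d) (by positivity)]
    refine mul_le_mul' ?_ le_rfl
    rw [ENNReal.ofReal_pow (by norm_num)]
    simpa using (Nat.cast_le (α := ℝ≥0∞)).2 hNcard
  · have := sum_inner_sq_le_of_net hN hω u
    linarith

/-- The quadratic form of a single vector, tested at that vector, is the fourth power of its norm.
-/
lemma holdsExcept_norm_sq_le {x : Ω → EuclideanSpace ℝ (Fin d)}
    (hx : Measurable x) {τ : ℝ} (hτ : 0 < τ)
    (hsub : vecPsi2Norm P x ≤ ENNReal.ofReal τ) {T : ℝ} (hT : 0 ≤ T) :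
    HoldsExcept P (ENNReal.ofReal (5 ^ d * 2 * Real.exp (-T)))
      fun ω => ‖x ω‖ ^ 2 ≤ 16 * τ ^ 2 * T := by
  have := holdsExcept_sum_inner_sq_le (ι := Unit) (P := P) (g := fun _ => x) (fun _ => hx)
    iIndepFun.of_subsingleton hτ (fun _ => hsub) T
  refine this.mono (by simp) fun ω hω => ?_
  have h1 := hω (x ω)
  simp only [Finset.univ_unique, Finset.sum_singleton, real_inner_self_eq_norm_sq] at h1
  by_cases h0 : ‖x ω‖ ^ 2 = 0
  · rw [h0]
    positivity
  · rw [sq (‖x ω‖ ^ 2)] at h1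
    exact le_of_mul_le_mul_right h1 (lt_of_le_of_ne (sq_nonneg _) (Ne.symm h0))

/-- Decoupling: the inner product of one noise vector with the sum of some others is of the order of
the square root of their number. -/
lemma holdsExcept_abs_inner_sum_le {ι : Type*} {g : ι → Ω → EuclideanSpace ℝ (Fin d)}
    (hg : ∀ i, Measurable (g i)) (hind : iIndepFun g P) (h0 : ∀ i, ∫ ω, g i ω ∂P = 0)
    {τ : ℝ} (hτ : 0 < τ) (hsub : ∀ i, vecPsi2Norm P (g i) ≤ ENNReal.ofReal τ)
    {S : Finset ι} {j : ι} (hj : j ∉ S) {m R x : ℝ} (hm : (S.card : ℝ) ≤ m)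
    (hR : 0 < R) (hx : 0 ≤ x) :
    HoldsExcept P (ENNReal.ofReal (2 * Real.exp (-x ^ 2 / (16 * m * τ ^ 2 * R ^ 2))))
      fun ω => ‖g j ω‖ ≤ R → |inner ℝ (∑ i ∈ S, g i ω) (g j ω)| ≤ x := by
  have hm0 : 0 ≤ m := (Nat.cast_nonneg _).trans hm
  set c := Real.toNNReal (8 * m * τ ^ 2 * R ^ 2) with hc
  have hcR : (c : ℝ) = 8 * m * τ ^ 2 * R ^ 2 := Real.coe_toNNReal _ (by positivity)
  set Z : Ω → EuclideanSpace ℝ (Fin d) := fun ω => ∑ i ∈ S, g i ω with hZ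
  have hZm : Measurable Z := Finset.measurable_sum _ fun i _ => hg i
  have hslice : ∀ v : EuclideanSpace ℝ (Fin d), ‖v‖ ≤ R →
      P {ω | x ≤ |inner ℝ (Z ω) v|} ≤
        ENNReal.ofReal (2 * Real.exp (-x ^ 2 / (16 * m * τ ^ 2 * R ^ 2))) := by
    intro v hv
    have h1 : HasSubgaussianMGF (fun ω => (inner ℝ (Z ω) v : ℝ)) c P := by
      have h2 := HasSubgaussianMGF.sum_of_iIndepFun
        (hind.comp (fun _ (y : EuclideanSpace ℝ (Fin d)) => (inner ℝ y v : ℝ))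
          fun i => by fun_prop) (s := S)
        (fun i _ => hasSubgaussianMGF_inner hτ (hg i) (hsub i) (h0 i) hR hv)
      simp only [Function.comp_apply, ← sum_inner] at h2
      refine ⟨h2.1, fun t => (h2.2 t).trans (Real.exp_le_exp.2 ?_)⟩
      have : ((∑ i ∈ S, Real.toNNReal (8 * τ ^ 2 * R ^ 2) : NNReal) : ℝ) ≤ c := by
        rw [hcR, Finset.sum_const, nsmul_eq_mul]
        push_cast
        rw [Real.coe_toNNReal _ (by positivity)]
        calc (S.card : ℝ) * (8 * τ ^ 2 * R ^ 2) ≤ m * (8 * τ ^ 2 * R ^ 2) := by gcongr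
          _ = _ := by ring
      gcongr
    have hexp : 2 * (c : ℝ) = 16 * m * τ ^ 2 * R ^ 2 := by rw [hcR]; ring
    have h2 := h1.measure_ge_le hx
    have h3 := h1.neg.measure_ge_le hx
    rw [hexp] at h2 h3
    have hsub : {ω | x ≤ |inner ℝ (Z ω) v|} ⊆
        {ω | x ≤ inner ℝ (Z ω) v} ∪ {ω | x ≤ (-fun ω => (inner ℝ (Z ω) v : ℝ)) ω} := by
      intro ω hω
      simp only [Set.mem_ofPred_eq, Set.mem_union, Pi.neg_apply] at hω ⊢
      exact le_abs.1 hω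
    rw [← ofReal_measureReal]
    refine ENNReal.ofReal_le_ofReal ?_
    refine (measureReal_mono hsub).trans ((measureReal_union_le _ _).trans ?_)
    linarith
  have hmeas : MeasurableSet {p : EuclideanSpace ℝ (Fin d) × EuclideanSpace ℝ (Fin d) |
      ‖p.1‖ ≤ R ∧ x ≤ |inner ℝ p.2 p.1|} := by
    have h1 : MeasurableSet {p : EuclideanSpace ℝ (Fin d) × EuclideanSpace ℝ (Fin d) |
        ‖p.1‖ ≤ R} := measurableSet_le (by fun_prop) (by fun_prop)
    have h2 : MeasurableSet {p : EuclideanSpace ℝ (Fin d) × EuclideanSpace ℝ (Fin d) |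
        x ≤ |(inner ℝ p.2 p.1 : ℝ)|} := by
      refine measurableSet_le (by fun_prop) ?_
      have : Measurable fun p : EuclideanSpace ℝ (Fin d) × EuclideanSpace ℝ (Fin d) =>
        (inner ℝ p.2 p.1 : ℝ) := by fun_prop
      simpa only [Real.norm_eq_abs] using this.norm
    exact h1.inter h2
  have hindep : IndepFun (g j) Z P := by
    have := (hind.indepFun_finsetSum_of_notMem hg hj).symm
    convert this using 1
    ext1 ω; simp [hZ]
  have hprob : P {ω | ‖g j ω‖ ≤ R ∧ x ≤ |inner ℝ (Z ω) (g j ω)|} ≤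
      ENNReal.ofReal (2 * Real.exp (-x ^ 2 / (16 * m * τ ^ 2 * R ^ 2))) := by
    have h1 : P {ω | ‖g j ω‖ ≤ R ∧ x ≤ |inner ℝ (Z ω) (g j ω)|} =
        (P.map fun ω => (g j ω, Z ω)) {p | ‖p.1‖ ≤ R ∧ x ≤ |inner ℝ p.2 p.1|} := by
      rw [Measure.map_apply ((hg j).prodMk hZm) hmeas]; rfl
    have := Measure.isProbabilityMeasure_map (μ := P) (hg j).aemeasurable
    have := Measure.isProbabilityMeasure_map (μ := P) hZm.aemeasurable
    -- By independence the joint law is a product, so g j can be frozen at a vector of norm at most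
    -- R and the fixed-direction tail bound applied.
    rw [h1, hindep.map_prod_eq_prod_map_map (hg j).aemeasurable hZm.aemeasurable,
      Measure.prod_apply hmeas]
    refine lintegral_le_const (Filter.Eventually.of_forall fun v => ?_)
    by_cases hv : ‖v‖ ≤ R
    · rw [Measure.map_apply hZm (measurable_prodMk_left hmeas)]
      refine (measure_mono fun ω hω => ?_).trans (hslice v hv)
      exact hω.2
    · have : Prod.mk v ⁻¹' {p : EuclideanSpace ℝ (Fin d) × EuclideanSpace ℝ (Fin d) |
          ‖p.1‖ ≤ R ∧ x ≤ |inner ℝ p.2 p.1|} = ∅ := by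
        ext w; simp [hv]
      rw [this]; simp
  have hM : Measurable fun ω => (g j ω, Z ω) := (hg j).prodMk hZm
  refine (HoldsExcept.of_not (Q := fun ω => ¬ (‖g j ω‖ ≤ R ∧ x ≤ |inner ℝ (Z ω) (g j ω)|))
    (hM hmeas).compl ?_).mono le_rfl fun ω hω h => ?_
  · simpa only [not_not] using hprob
  · by_contra hcon
    exact hω ⟨h, (not_le.1 hcon).le⟩

end Noise

/-! ### Levels of the linear noise. -/

section Levels

variable {Ω : Type u} [MeasurableSpace Ω] {P : Measure Ω} [IsProbabilityMeasure P]

lemma log_le_two_mul_sqrt {x : ℝ} (hx : 0 < x) : Real.log x ≤ 2 * Real.sqrt x := by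
  have h1 := Real.log_le_sub_one_of_pos (Real.sqrt_pos.2 hx)
  rw [Real.log_sqrt hx.le] at h1
  linarith

/-- If independent nonnegative variables have means at most `exp (-t)`, then either all of them are
less than one or the sum of their logarithms is exponentially small. -/
lemma holdsExcept_sum_log_le {n : ℕ} (hn : 0 < n) {W : Fin n → Ω → ℝ}
    (hW : ∀ j, Measurable (W j)) (hW0 : ∀ j ω, 0 ≤ W j ω) (hind : iIndepFun W P) {t : ℝ}
    (ht : 0 ≤ t) (hE : ∀ j, ∫⁻ ω, ENNReal.ofReal (W j ω) ∂P ≤ ENNReal.ofReal (Real.exp (-t))) :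
    HoldsExcept P (ENNReal.ofReal (1 / (4 * n))) fun ω =>
      (∀ j, W j ω < 1) ∨ ∑ j, Real.log (1 + W j ω) ≤ 9 * n * Real.exp (-t / 4) := by
  have hnR : (0 : ℝ) < n := by positivity
  -- When the expected total is tiny, Markov and a union bound make every variable less than one.
  -- Otherwise exp(-t) exceeds 1/(4n²), so the log(4n) lost in Markov's inequality for the product
  -- is at most of order n exp(-t/4).
  rcases le_or_gt (n * Real.exp (-t)) (1 / (4 * n)) with hcase | hcase
  · have h1 : ∀ j ∈ Finset.univ, HoldsExcept P (ENNReal.ofReal (Real.exp (-t)))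
        fun ω => W j ω < 1 := fun j _ => by
      refine (HoldsExcept.lt_of_lintegral_le (hW j).ennreal_ofReal one_ne_zero (by simp)
        (hE j)).mono (by simp) fun ω hω => ?_
      simpa using hω
    refine (HoldsExcept.forall_mem _ h1).mono ?_ fun ω hω => Or.inl fun j => hω j (by simp)
    rw [Finset.card_univ, Fintype.card_fin, ← ENNReal.ofReal_natCast,
      ← ENNReal.ofReal_mul (by positivity)]
    exact ENNReal.ofReal_le_ofReal hcase
  · set f : Fin n → Ω → ℝ≥0∞ := fun j ω => ENNReal.ofReal (1 + W j ω) with hf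
    have hfm : ∀ j, Measurable (f j) := fun j => by
      have := hW j
      simp only [hf]; fun_prop
    have hfind : iIndepFun f P := hind.comp (fun _ (x : ℝ) => ENNReal.ofReal (1 + x))
      fun i => by fun_prop
    have hint : ∫⁻ ω, ∏ j, f j ω ∂P ≤ ENNReal.ofReal (Real.exp (n * Real.exp (-t))) := by
      rw [lintegral_prod_eq_prod_lintegral_of_indepFun _ f hfind hfm]
      calc ∏ j, ∫⁻ ω, f j ω ∂P ≤ ∏ _j : Fin n, ENNReal.ofReal (Real.exp (Real.exp (-t))) := by
            refine Finset.prod_le_prod' fun j _ => ?_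
            have h2 : ∫⁻ ω, f j ω ∂P = 1 + ∫⁻ ω, ENNReal.ofReal (W j ω) ∂P := by
              simp only [hf, ENNReal.ofReal_add zero_le_one (hW0 j _), ENNReal.ofReal_one]
              rw [lintegral_add_left measurable_const]
              simp
            rw [h2]
            refine (add_le_add le_rfl (hE j)).trans ?_
            rw [← ENNReal.ofReal_one, ← ENNReal.ofReal_add zero_le_one (Real.exp_pos _).le]
            refine ENNReal.ofReal_le_ofReal ?_
            linarith [Real.add_one_le_exp (Real.exp (-t))]
        _ = _ := by
            rw [Finset.prod_const, Finset.card_univ, Fintype.card_fin,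
              ← ENNReal.ofReal_pow (Real.exp_pos _).le, ← Real.exp_nat_mul]
    have hA : 0 < 4 * n * Real.exp (n * Real.exp (-t)) := by positivity
    refine (HoldsExcept.lt_of_lintegral_le (Finset.measurable_prod _ fun j _ => hfm j)
      (a := ENNReal.ofReal (4 * n * Real.exp (n * Real.exp (-t)))) (ENNReal.ofReal_pos.2 hA).ne'
      ENNReal.ofReal_ne_top hint).mono ?_ fun ω hω => Or.inr ?_
    · rw [← ENNReal.ofReal_div_of_pos hA]
      refine ENNReal.ofReal_le_ofReal (le_of_eq ?_)
      field_simp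
    · simp only [hf] at hω
      have hpos : ∀ j, 0 < 1 + W j ω := fun j => by linarith [hW0 j ω]
      rw [← ENNReal.ofReal_prod_of_nonneg fun j _ => (hpos j).le,
        ENNReal.ofReal_lt_ofReal_iff hA] at hω
      have hlog := Real.log_le_log (Finset.prod_pos fun j _ => hpos j) hω.le
      rw [Real.log_prod fun j _ => (hpos j).ne', Real.log_mul (by positivity)
        (Real.exp_pos _).ne', Real.log_exp] at hlog
      refine hlog.trans ?_
      set y := Real.exp (-t / 4) with hy
      have hy0 : 0 < y := Real.exp_pos _
      have hy1 : y ≤ 1 := Real.exp_le_one_iff.2 (by linarith)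
      have hy4 : Real.exp (-t) = y ^ 4 := by rw [hy, ← Real.exp_nat_mul]; congr 1; push_cast; ring
      rw [hy4] at hcase ⊢
      have hlog4 := log_le_two_mul_sqrt (show (0 : ℝ) < 4 * n by positivity)
      have hs : Real.sqrt (4 * n) = 2 * Real.sqrt n := by
        rw [Real.sqrt_mul (by norm_num), show (4 : ℝ) = 2 ^ 2 by norm_num,
          Real.sqrt_sq (by norm_num)]
      rw [hs] at hlog4
      have h5 : y ^ 4 ≤ y := by
        calc y ^ 4 ≤ y ^ 1 := pow_le_pow_of_le_one hy0.le hy1 (by norm_num)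
          _ = y := pow_one y
      have h6 : 1 ≤ (2 * n * y ^ 2) := by
        rw [div_lt_iff₀ (by positivity)] at hcase
        have : 1 ^ 2 ≤ (2 * n * y ^ 2) ^ 2 := by nlinarith
        exact (sq_le_sq₀ zero_le_one (by positivity)).1 this
      have h7 : Real.sqrt n ≤ 2 * n * y := by
        refine Real.sqrt_le_iff.2 ⟨by positivity, ?_⟩
        nlinarith
      -- The 9 is 8 from log(4n) ≤ 4 √n ≤ 8 n y, plus 1 from n y⁴ ≤ n y.
      nlinarith

/-- With scale θ in place of 1/(256 τ²), the exponent of the bound is -θ‖δ‖²/8 + 16 τ²θ²‖δ‖², and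
this θ minimizes it. -/
lemma lintegral_exp_noise_le {d : ℕ} {x : Ω → EuclideanSpace ℝ (Fin d)} {τ : ℝ} (hτ : 0 < τ)
    (hx : Measurable x) (h : vecPsi2Norm P x ≤ ENNReal.ofReal τ) (h0 : ∫ ω, x ω ∂P = 0)
    {δ : EuclideanSpace ℝ (Fin d)} (hδ : 0 < ‖δ‖) :
    ∫⁻ ω, ENNReal.ofReal (Real.exp ((2 * inner ℝ δ (x ω) - ‖δ‖ ^ 2 / 8) / (256 * τ ^ 2))) ∂P ≤
      ENNReal.ofReal (Real.exp (-(‖δ‖ ^ 2 / (4096 * τ ^ 2)))) := by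
  have hsg := hasSubgaussianMGF_inner hτ hx h h0 hδ le_rfl
  have hpt : ∀ ω, Real.exp ((2 * inner ℝ δ (x ω) - ‖δ‖ ^ 2 / 8) / (256 * τ ^ 2)) =
      Real.exp (-(‖δ‖ ^ 2 / (2048 * τ ^ 2))) *
        Real.exp (1 / (128 * τ ^ 2) * inner ℝ (x ω) δ) := fun ω => by
    rw [← Real.exp_add, real_inner_comm]
    congr 1
    field_simp
    ring
  simp only [hpt]
  rw [← ofReal_integral_eq_lintegral_ofReal ((hsg.1 _).const_mul _)
    (Filter.Eventually.of_forall fun ω => by positivity), integral_const_mul]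
  refine ENNReal.ofReal_le_ofReal ?_
  refine (mul_le_mul_of_nonneg_left (hsg.2 (1 / (128 * τ ^ 2))) (Real.exp_pos _).le).trans ?_
  rw [← Real.exp_add, Real.coe_toNNReal _ (by positivity)]
  refine Real.exp_le_exp.2 (le_of_eq ?_)
  field_simp
  ring

/-- The linear part of the noise exceeds the signal only slightly on average. -/
lemma IsSGMM.holdsExcept_exists_level {n k d : ℕ} {σ : Fin n → Fin k}
    {g : Fin n → Ω → EuclideanSpace ℝ (Fin d)} {τ : ℝ} (h : IsSGMM P σ g τ) (hτ : 0 < τ)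
    (hn : 0 < n) (μ : Fin k → EuclideanSpace ℝ (Fin d)) {Δ t : ℝ} (hΔ0 : 0 < Δ)
    (hΔ : ∀ a b, a ≠ b → Δ ≤ ‖μ a - μ b‖ ^ 2) (ht0 : 0 ≤ t)
    (ht : k * Real.exp (-(Δ / (4096 * τ ^ 2))) ≤ Real.exp (-t)) :
    HoldsExcept P (ENNReal.ofReal (1 / (4 * n))) fun ω =>
      ∃ X : Fin n → ℝ, (∀ j, 0 ≤ X j) ∧
        (∀ i j, σ i ≠ σ j → 2 * inner ℝ (μ (σ i) - μ (σ j)) (g j ω) -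
          ‖μ (σ i) - μ (σ j)‖ ^ 2 / 8 ≤ X j) ∧
        ∑ j, X j ≤ 256 * τ ^ 2 * (9 * n * Real.exp (-t / 4)) := by
  -- A sum of exponentials stands in for the maximum over wrong clusters; its logarithm will serve
  -- as the level.
  let F : Fin n → EuclideanSpace ℝ (Fin d) → ℝ := fun j x =>
    ∑ b ∈ Finset.univ.filter (fun b => b ≠ σ j),
      Real.exp ((2 * inner ℝ (μ b - μ (σ j)) x - ‖μ b - μ (σ j)‖ ^ 2 / 8) / (256 * τ ^ 2))
  have hF0 : ∀ j x, 0 ≤ F j x := fun j x => Finset.sum_nonneg fun b _ => (Real.exp_pos _).le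
  have hFm : ∀ j, Measurable (F j) := fun j =>
    Finset.measurable_sum _ fun b _ => by fun_prop
  have hFterm : ∀ i j x, σ i ≠ σ j → Real.exp ((2 * inner ℝ (μ (σ i) - μ (σ j)) x -
      ‖μ (σ i) - μ (σ j)‖ ^ 2 / 8) / (256 * τ ^ 2)) ≤ F j x := fun i j x hij =>
    Finset.single_le_sum (f := fun b => Real.exp ((2 * inner ℝ (μ b - μ (σ j)) x -
      ‖μ b - μ (σ j)‖ ^ 2 / 8) / (256 * τ ^ 2))) (fun b _ => (Real.exp_pos _).le) (by simp [hij])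
  have hE : ∀ j, ∫⁻ ω, ENNReal.ofReal (F j (g j ω)) ∂P ≤ ENNReal.ofReal (Real.exp (-t)) := by
    intro j
    have hgj := h.measurable j
    have h1 : ∀ ω, ENNReal.ofReal (F j (g j ω)) =
        ∑ b ∈ Finset.univ.filter (fun b => b ≠ σ j), ENNReal.ofReal (Real.exp
          ((2 * inner ℝ (μ b - μ (σ j)) (g j ω) - ‖μ b - μ (σ j)‖ ^ 2 / 8) / (256 * τ ^ 2))) :=
      fun ω => ENNReal.ofReal_sum_of_nonneg fun b _ => (Real.exp_pos _).le
    simp only [h1]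
    rw [lintegral_finsetSum _ fun b _ => by fun_prop]
    have h2 : ∀ b ∈ Finset.univ.filter (fun b => b ≠ σ j), ∫⁻ ω, ENNReal.ofReal (Real.exp
        ((2 * inner ℝ (μ b - μ (σ j)) (g j ω) - ‖μ b - μ (σ j)‖ ^ 2 / 8) / (256 * τ ^ 2))) ∂P ≤
        ENNReal.ofReal (Real.exp (-(Δ / (4096 * τ ^ 2)))) := by
      intro b hb
      have hD := hΔ b (σ j) (by simpa using hb)
      have hδ : 0 < ‖μ b - μ (σ j)‖ := by
        by_contra hcon
        have : ‖μ b - μ (σ j)‖ = 0 := le_antisymm (not_lt.1 hcon) (norm_nonneg _)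
        rw [this] at hD
        linarith
      refine (lintegral_exp_noise_le hτ hgj (h.subGaussian j) (h.centered j) hδ).trans ?_
      gcongr
    refine (Finset.sum_le_card_nsmul _ _ _ h2).trans ?_
    refine le_trans ?_ (ENNReal.ofReal_le_ofReal ht)
    rw [nsmul_eq_mul, ENNReal.ofReal_mul (by positivity), ENNReal.ofReal_natCast]
    refine mul_le_mul' ?_ le_rfl
    have := Finset.card_filter_le (Finset.univ : Finset (Fin k)) (fun b => b ≠ σ j)
    rw [Finset.card_univ, Fintype.card_fin] at this
    exact_mod_cast this
  refine (holdsExcept_sum_log_le hn (W := fun j ω => F j (g j ω))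
    (fun j => (hFm j).comp (h.measurable j)) (fun j ω => hF0 j _) (h.indep.comp F hFm) ht0
    hE).mono le_rfl fun ω hω => ?_
  have hτ2 : 0 < 256 * τ ^ 2 := by positivity
  rcases hω with hω | hω
  -- If F < 1, every exponent is nonpositive, so the zero level is admissible.
  · refine ⟨fun _ => 0, fun _ => le_rfl, fun i j hij => ?_, by simp; positivity⟩
    have h1 := (hFterm i j (g j ω) hij).trans (hω j).le
    rw [Real.exp_le_one_iff, div_le_iff₀ hτ2] at h1
    linarith
  · refine ⟨fun j => 256 * τ ^ 2 * Real.log (1 + F j (g j ω)), fun j => ?_, fun i j hij => ?_, ?_⟩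
    · exact mul_nonneg hτ2.le (Real.log_nonneg (by linarith [hF0 j (g j ω)]))
    · have h1 := hFterm i j (g j ω) hij
      have h2 := (Real.le_log_iff_exp_le (by linarith [hF0 j (g j ω)])).2
        (h1.trans (by linarith : F j (g j ω) ≤ 1 + F j (g j ω)))
      rwa [div_le_iff₀' hτ2] at h2
    · rw [← Finset.mul_sum]
      exact mul_le_mul_of_nonneg_left hω hτ2.le

end Levels

/-! ### Near-orthogonality to the noise means, and the final error bound. -/

section Recovery

lemma clusterMean_eq_sum {n k : ℕ} {σ : Fin n → Fin k} {E : Type*} [AddCommGroup E] [Module ℝ E]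
    (g : Fin n → E) (i : Fin n) :
    clusterMean σ g i = ((n : ℝ) / k)⁻¹ • ∑ l ∈ Finset.univ.filter (fun l => σ l = σ i), g l := by
  simp [clusterMean, clusterMatrix, Finset.sum_filter, eq_comm]

/-- The only term where g j meets itself is minus a multiple of ‖g j‖², which has the favourable
sign. The other sums omit j, as decoupling requires. -/
lemma inner_clusterMean_sub_le {n k : ℕ} {σ : Fin n → Fin k} {E : Type*} [NormedAddCommGroup E]
    [InnerProductSpace ℝ E] {g : Fin n → E} {i j : Fin n} {x : ℝ} (hij : σ i ≠ σ j)
    (hx : ∀ b, |inner ℝ (∑ l ∈ Finset.univ.filter (fun l => σ l = b ∧ l ≠ j), g l) (g j)| ≤ x) :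
    inner ℝ (clusterMean σ g i - clusterMean σ g j) (g j) ≤ ((n : ℝ) / k)⁻¹ * (2 * x) := by
  have h1 : (Finset.univ.filter fun l => σ l = σ i) =
      Finset.univ.filter fun l => σ l = σ i ∧ l ≠ j := by
    ext l
    simp only [Finset.mem_filter, Finset.mem_univ, true_and, iff_self_and]
    rintro h rfl
    exact hij h.symm
  have h2 : ∑ l ∈ Finset.univ.filter (fun l => σ l = σ j), g l =
      g j + ∑ l ∈ Finset.univ.filter (fun l => σ l = σ j ∧ l ≠ j), g l := by
    rw [← Finset.add_sum_erase _ _ (show j ∈ Finset.univ.filter (fun l => σ l = σ j) by simp)]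
    congr 2
    ext l
    simp [and_comm]
  rw [clusterMean_eq_sum, clusterMean_eq_sum, h1, h2, ← smul_sub, real_inner_smul_left]
  refine mul_le_mul_of_nonneg_left ?_ (by positivity)
  rw [inner_sub_left, inner_add_left, real_inner_self_eq_norm_sq]
  have e1 := (abs_le.1 (hx (σ i))).2
  have e2 := (abs_le.1 (hx (σ j))).1
  nlinarith [sq_nonneg ‖g j‖]

lemma exp_neg_natCast_mul_log {n : ℕ} (hn : 0 < n) (a : ℕ) :
    Real.exp (-(a * Real.log n)) = ((n : ℝ) ^ a)⁻¹ := by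
  rw [Real.exp_neg, Real.exp_nat_mul, Real.exp_log (by exact_mod_cast hn)]

variable {Ω : Type u} [MeasurableSpace Ω] {P : Measure Ω} [IsProbabilityMeasure P]

lemma IsBalanced.le {n k : ℕ} {σ : Fin n → Fin k} (hσ : IsBalanced σ) (hk : 0 < k) (hn : 0 < n) :
    k ≤ n := by
  have h := hσ.mul_div hk
  rcases Nat.eq_zero_or_pos (n / k) with h0 | h0
  · rw [h0] at h; omega
  · nlinarith

/-- The noise vectors are nearly orthogonal to the cluster means of the noise. -/
lemma IsSGMM.holdsExcept_inner_clusterMean_le {n k d : ℕ} {σ : Fin n → Fin k}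
    {g : Fin n → Ω → EuclideanSpace ℝ (Fin d)} {τ : ℝ} (h : IsSGMM P σ g τ) (hτ : 0 < τ)
    (hn : 4 ≤ n) (hk : 0 < k) {Δ : ℝ} (hΔ0 : 0 ≤ Δ)
    (hΔ : 5 * Real.log n * (2 ^ 20 * τ ^ 4 * (2 * d + 4 * Real.log n)) ≤ (n : ℝ) / k * Δ ^ 2) :
    HoldsExcept P (ENNReal.ofReal (1 / (4 * n)) + ENNReal.ofReal (1 / (4 * n))) fun ω =>
      ∀ i j, σ i ≠ σ j →
        inner ℝ (clusterMean σ (fun l => g l ω) i - clusterMean σ (fun l => g l ω) j) (g j ω) ≤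
          Δ / 32 := by
  have hn0 : 0 < n := by omega
  have hnR : (4 : ℝ) ≤ n := by exact_mod_cast hn
  have hkR : (0 : ℝ) < k := by positivity
  have hkn : (k : ℝ) ≤ n := by exact_mod_cast h.balanced.le hk hn0
  have hlog : 0 < Real.log n := Real.log_pos (by linarith)
  -- The term 2d pays for the net of size 5^d, and 4 log n for the union over the points.
  set T : ℝ := 2 * d + 4 * Real.log n with hT
  have hT0 : 0 < T := by positivity
  set m : ℝ := (n : ℝ) / k with hm
  have hm0 : 0 < m := by positivity
  set R : ℝ := 4 * τ * Real.sqrt T with hR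
  have hR0 : 0 < R := by positivity
  have hR2 : R ^ 2 = 16 * τ ^ 2 * T := by rw [hR, mul_pow, Real.sq_sqrt hT0.le]; ring
  -- Chosen so that 2x/m = Δ/32; the tail exponent is then m Δ²/(2²⁰ τ⁴ T), which `hΔ` makes at
  -- least 5 log n.
  set x : ℝ := m * Δ / 64 with hx
  have e1 : HoldsExcept P (ENNReal.ofReal (1 / (4 * n))) fun ω =>
      ∀ j ∈ Finset.univ, ‖g j ω‖ ^ 2 ≤ 16 * τ ^ 2 * T := by
    refine (HoldsExcept.forall_mem Finset.univ fun j _ =>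
      holdsExcept_norm_sq_le (h.measurable j) hτ (h.subGaussian j) hT0.le).mono ?_ fun ω hω => hω
    rw [Finset.card_univ, Fintype.card_fin, ← ENNReal.ofReal_natCast,
      ← ENNReal.ofReal_mul (by positivity)]
    refine ENNReal.ofReal_le_ofReal ?_
    have h5 : (5 : ℝ) ^ d ≤ Real.exp (2 * d) := by
      rw [mul_comm, Real.exp_nat_mul]
      refine pow_le_pow_left₀ (by norm_num) ?_ d
      have := Real.quadratic_le_exp_of_nonneg (show (0 : ℝ) ≤ 2 by norm_num)
      linarith
    have h6 : Real.exp (-T) = Real.exp (-(2 * d)) * ((n : ℝ) ^ 4)⁻¹ := by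
      have := exp_neg_natCast_mul_log hn0 4
      push_cast at this
      rw [← this, ← Real.exp_add, hT]; ring_nf
    have h7 : (5 : ℝ) ^ d * Real.exp (-(2 * d)) ≤ 1 := by
      rw [Real.exp_neg, ← div_eq_mul_inv]
      exact div_le_one_of_le₀ h5 (Real.exp_pos _).le
    calc (n : ℝ) * (5 ^ d * 2 * Real.exp (-T))
        = (5 ^ d * Real.exp (-(2 * d))) * (2 * n * ((n : ℝ) ^ 4)⁻¹) := by rw [h6]; ring
      _ ≤ 1 * (2 * n * ((n : ℝ) ^ 4)⁻¹) := by gcongr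
      _ ≤ 1 / (4 * n) := by
          rw [one_mul, ← div_eq_mul_inv, div_le_div_iff₀ (by positivity) (by positivity)]
          have h8 : (n : ℝ) ^ 4 = n ^ 2 * n ^ 2 := by ring
          have h9 : (16 : ℝ) ≤ n ^ 2 := by nlinarith
          nlinarith
  have e2 : HoldsExcept P (ENNReal.ofReal (1 / (4 * n))) fun ω =>
      ∀ q ∈ (Finset.univ : Finset (Fin n × Fin k)), ‖g q.1 ω‖ ≤ R →
        |inner ℝ (∑ l ∈ Finset.univ.filter (fun l => σ l = q.2 ∧ l ≠ q.1), g l ω) (g q.1 ω)|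
          ≤ x := by
    refine (HoldsExcept.forall_mem Finset.univ fun q _ =>
      holdsExcept_abs_inner_sum_le h.measurable h.indep h.centered hτ h.subGaussian
        (m := m) (by simp) ?_ hR0 (by positivity)).mono ?_ fun ω hω => hω
    · rw [hm, h.balanced.cast_div hk, ← h.balanced.card_eq hk q.2]
      refine Nat.cast_le.2 (Finset.card_le_card fun i hi => ?_)
      simp only [Finset.mem_filter, Finset.mem_univ, true_and] at hi ⊢
      exact hi.1
    · rw [Finset.card_univ, Fintype.card_prod, Fintype.card_fin, Fintype.card_fin,
        ← ENNReal.ofReal_natCast, ← ENNReal.ofReal_mul (by positivity)]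
      refine ENNReal.ofReal_le_ofReal ?_
      have h8 : Real.exp (-x ^ 2 / (16 * m * τ ^ 2 * R ^ 2)) ≤ ((n : ℝ) ^ 5)⁻¹ := by
        have := exp_neg_natCast_mul_log hn0 5
        push_cast at this
        rw [← this]
        refine Real.exp_le_exp.2 ?_
        rw [neg_div, neg_le_neg_iff, le_div_iff₀ (by positivity), hR2, hx]
        have h9 := mul_le_mul_of_nonneg_left hΔ (show 0 ≤ m / 4096 by positivity)
        nlinarith [h9]
      push_cast
      calc (n : ℝ) * k * (2 * Real.exp (-x ^ 2 / (16 * m * τ ^ 2 * R ^ 2)))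
          ≤ n * n * (2 * ((n : ℝ) ^ 5)⁻¹) := by gcongr
        _ ≤ 1 / (4 * n) := by
          rw [← mul_assoc, ← div_eq_mul_inv, div_le_div_iff₀ (by positivity) (by positivity)]
          have : (n : ℝ) ^ 5 = n ^ 3 * n ^ 2 := by ring
          have h10 : (0 : ℝ) < n ^ 3 := by positivity
          have h11 : (16 : ℝ) ≤ n ^ 2 := by nlinarith
          nlinarith [mul_le_mul_of_nonneg_left h11 h10.le]
  refine (e1.and e2).mono le_rfl fun ω ⟨hω1, hω2⟩ i j hij => ?_
  have hgj : ‖g j ω‖ ≤ R := by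
    refine (sq_le_sq₀ (norm_nonneg _) hR0.le).1 ?_
    rw [hR2]
    exact hω1 j (Finset.mem_univ _)
  refine (inner_clusterMean_sub_le hij fun b => hω2 (j, b) (Finset.mem_univ _) hgj).trans
    (le_of_eq ?_)
  rw [hx, ← hm]
  field_simp
  ring

lemma minSep_le {k d : ℕ} (μ : Fin k → EuclideanSpace ℝ (Fin d)) {a b : Fin k} (hab : a ≠ b) :
    minSep μ ≤ ‖μ a - μ b‖ :=
  ciInf_le (f := fun p : {p : Fin k × Fin k // p.1 ≠ p.2} => ‖μ p.1.1 - μ p.1.2‖)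
    (Set.finite_range _).bddBelow ⟨(a, b), hab⟩

lemma minSep_nonneg {k d : ℕ} (μ : Fin k → EuclideanSpace ℝ (Fin d)) : 0 ≤ minSep μ :=
  Real.iInf_nonneg fun _ => norm_nonneg _

/-- Exponential decay of the error rate of clustering by the semidefinite program. -/
theorem IsSGMM.holdsExcept_misRate_le {n k d : ℕ} {σ : Fin n → Fin k}
    {g : Fin n → Ω → EuclideanSpace ℝ (Fin d)} {τ : ℝ} (h : IsSGMM P σ g τ) (hτ : 0 < τ)
    (hn : 4 ≤ n) (hk : 2 ≤ k) (μ : Fin k → EuclideanSpace ℝ (Fin d))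
    (hs : 48000 * (Real.sqrt ((k : ℝ) * d / n * Real.log n) + (k : ℝ) * d / n + k) ≤
      snr μ τ ^ 2) :
    HoldsExcept P (ENNReal.ofReal (2 / n)) fun ω =>
      ∀ (Y : Matrix (Fin n) (Fin n) ℝ) (σhat : Fin n → Fin k),
        IsSDPSolution k (distMatrix (dataPoint μ σ (fun i => g i ω))) Y →
        IsClusterOutput Y σhat →
        misRate σhat σ ≤ 884736 * Real.exp (-(snr μ τ ^ 2) / 32768) := by
  have hn0 : 0 < n := by omega
  have hk0 : 0 < k := by omega
  have hnR : (4 : ℝ) ≤ n := by exact_mod_cast hn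
  have hkR : (2 : ℝ) ≤ k := by exact_mod_cast hk
  have hnpos : (0 : ℝ) < n := by linarith
  have hkpos : (0 : ℝ) < k := by linarith
  have hlog : 0 < Real.log n := Real.log_pos (by linarith)
  set s2 : ℝ := snr μ τ ^ 2 with hs2
  set q : ℝ := Real.sqrt ((k : ℝ) * d / n * Real.log n) with hq
  have hq0 : 0 ≤ q := Real.sqrt_nonneg _
  have hq2 : q ^ 2 = (k : ℝ) * d / n * Real.log n := Real.sq_sqrt (by positivity)
  have hkd : 0 ≤ (k : ℝ) * d / n := by positivity
  have hs2k : 48000 * (k : ℝ) ≤ s2 := by linarith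
  have hs2pos : 0 < s2 := by linarith
  have hs2one : 1 ≤ s2 := by linarith
  set Δ : ℝ := s2 * τ ^ 2 with hΔ
  have hΔ0 : 0 < Δ := by positivity
  have hΔsep : Δ = minSep μ ^ 2 := by rw [hΔ, hs2, snr]; field_simp
  have hΔle : ∀ a b, a ≠ b → Δ ≤ ‖μ a - μ b‖ ^ 2 := fun a b hab => by
    rw [hΔsep]
    exact pow_le_pow_left₀ (minSep_nonneg μ) (minSep_le μ hab) 2
  set m : ℝ := (n : ℝ) / k with hm
  have hm0 : 0 < m := by positivity
  -- The choice 3(n + d) beats 5^d 2^n and leaves a failure probability of at most exp(-2n).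
  have ev1 := holdsExcept_sum_inner_sq_le h.measurable h.indep hτ h.subGaussian (3 * ((n : ℝ) + d))
  have ev2 := h.holdsExcept_inner_clusterMean_le hτ hn hk0 hΔ0.le (by
    have h1 : (48000 : ℝ) ^ 2 * (q ^ 2 + k ^ 2) ≤ s2 ^ 2 := by
      have : (48000 * (q + k)) ^ 2 ≤ s2 ^ 2 :=
        pow_le_pow_left₀ (by positivity) (by linarith) 2
      nlinarith [mul_nonneg hq0 hkpos.le]
    have h2 : Real.log n ^ 2 ≤ 4 * n := by
      have := log_le_two_mul_sqrt hnpos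
      calc Real.log n ^ 2 ≤ (2 * Real.sqrt n) ^ 2 := pow_le_pow_left₀ hlog.le this 2
        _ = 4 * n := by rw [mul_pow, Real.sq_sqrt hnpos.le]; norm_num
    have h3 : m * q ^ 2 = d * Real.log n := by rw [hq2, hm]; field_simp
    have h4 : m * (k : ℝ) ^ 2 = n * k := by rw [hm]; field_simp
    -- The square-root term of the hypothesis handles d log n; the term k handles log² n ≤ 4n, since
    -- m k² = n k.
    have h5 : 5 * Real.log n * (2 ^ 20 * (2 * d + 4 * Real.log n)) ≤ m * s2 ^ 2 := by
      have h6 := mul_le_mul_of_nonneg_left h1 hm0.le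
      have h7 : m * ((48000 : ℝ) ^ 2 * (q ^ 2 + k ^ 2)) =
          48000 ^ 2 * (d * Real.log n + n * k) := by rw [← h3, ← h4]; ring
      have h8 : 0 ≤ d * Real.log n := by positivity
      have h9 : (n : ℝ) ≤ n * k := by nlinarith
      nlinarith
    have h6 := mul_le_mul_of_nonneg_right h5 (show 0 ≤ τ ^ 4 by positivity)
    calc 5 * Real.log n * (2 ^ 20 * τ ^ 4 * (2 * d + 4 * Real.log n))
        = 5 * Real.log n * (2 ^ 20 * (2 * d + 4 * Real.log n)) * τ ^ 4 := by ring
      _ ≤ m * s2 ^ 2 * τ ^ 4 := h6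
      _ = m * Δ ^ 2 := by rw [hΔ]; ring)
  -- Half of the exponent s2/4096 is given up to absorb the number k of competing clusters.
  have ev3 := h.holdsExcept_exists_level hτ hn0 μ hΔ0 hΔle (t := s2 / 8192) (by positivity) (by
    have h1 : Δ / (4096 * τ ^ 2) = s2 / 4096 := by rw [hΔ]; field_simp
    have h2 : (k : ℝ) ≤ Real.exp (s2 / 8192) := by
      have := Real.add_one_le_exp (s2 / 8192)
      linarith
    rw [h1]
    calc (k : ℝ) * Real.exp (-(s2 / 4096))
        ≤ Real.exp (s2 / 8192) * Real.exp (-(s2 / 4096)) := by gcongr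
      _ = Real.exp (-(s2 / 8192)) := by rw [← Real.exp_add]; ring_nf)
  refine ((ev1.and ev2).and ev3).mono ?_ fun ω ⟨⟨hω1, hω2⟩, X, hX0, hX, hXsum⟩ Y σhat hY hout => ?_
  · have h1 : (5 : ℝ) ^ d * 2 ^ Fintype.card (Fin n) * Real.exp (-(3 * ((n : ℝ) + d))) ≤
        1 / (4 * n) := by
      rw [Fintype.card_fin]
      have h5 : (5 : ℝ) ^ d ≤ Real.exp (3 * d) := by
        rw [mul_comm, Real.exp_nat_mul]
        refine pow_le_pow_left₀ (by norm_num) ?_ d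
        have := Real.quadratic_le_exp_of_nonneg (show (0 : ℝ) ≤ 3 by norm_num)
        linarith
      have h2 : (2 : ℝ) ^ n ≤ Real.exp n := by
        rw [← mul_one (n : ℝ), Real.exp_nat_mul]
        refine pow_le_pow_left₀ (by norm_num) ?_ n
        linarith [Real.add_one_le_exp (1 : ℝ)]
      have h3 : 4 * (n : ℝ) ≤ Real.exp (2 * n) := by
        have := Real.add_one_le_exp (n : ℝ)
        have h4 : Real.exp (2 * n) = Real.exp n * Real.exp n := by rw [← Real.exp_add]; ring_nf
        rw [h4]
        nlinarith
      calc (5 : ℝ) ^ d * 2 ^ n * Real.exp (-(3 * ((n : ℝ) + d)))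
          ≤ Real.exp (3 * d) * Real.exp n * Real.exp (-(3 * ((n : ℝ) + d))) := by gcongr
        _ = (Real.exp (2 * n))⁻¹ := by
            rw [← Real.exp_add, ← Real.exp_add, ← Real.exp_neg]; ring_nf
        _ ≤ (4 * (n : ℝ))⁻¹ := by gcongr
        _ = 1 / (4 * n) := (one_div _).symm
    have h0 : (0 : ℝ) ≤ 1 / (4 * n) := by positivity
    refine (add_le_add (add_le_add (ENNReal.ofReal_le_ofReal h1) le_rfl) le_rfl).trans ?_
    rw [← ENNReal.ofReal_add h0 h0, ← ENNReal.ofReal_add h0 (by positivity),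
      ← ENNReal.ofReal_add (by positivity) h0]
    refine ENNReal.ofReal_le_ofReal ?_
    have : (1 : ℝ) / (4 * n) = 1 / n / 4 := by field_simp
    have h' : (2 : ℝ) / n = 2 * (1 / n) := by ring
    rw [this, h']
    have : (0 : ℝ) < 1 / n := by positivity
    linarith
  · have hK0 : (0 : ℝ) ≤ 16 * τ ^ 2 * (3 * ((n : ℝ) + d)) := by positivity
    have hmain := hY.offDiagMass_le h.balanced hk0 hn0 hK0 hω1 (Δ := Δ)
      (fun a b hab => by
        refine le_trans ?_ (hΔle a b hab)
        have h1 : 16 * τ ^ 2 * (3 * ((n : ℝ) + d)) * ((n : ℝ) / k)⁻¹ =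
            48 * τ ^ 2 * (k + (k : ℝ) * d / n) := by field_simp; ring
        rw [h1, hΔ]
        have h2 : 48000 * (k + (k : ℝ) * d / n) ≤ s2 := by linarith
        have h3 := mul_le_mul_of_nonneg_right h2 (sq_nonneg τ)
        linarith)
      hΔle
      (fun i j hij => (hω2 i j hij).trans (by linarith [hΔle _ _ hij])) hX0 hX
    have hmis := misRate_le_l1Norm hn hk h.balanced hout
    rw [hY.1.l1Norm_sub h.balanced hk0, l1Norm_clusterMatrix h.balanced hk0] at hmis
    refine hmis.trans ?_
    have hexp : Real.exp (-(s2 / 8192) / 4) = Real.exp (-s2 / 32768) := by congr 1; ring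
    set y := Real.exp (-s2 / 32768) with hy
    have hy0 : 0 < y := Real.exp_pos _
    rw [hexp] at hXsum
    have h1 : Δ / 8 * offDiagMass σ Y ≤ m * (256 * τ ^ 2 * (9 * n * y)) :=
      hmain.trans (mul_le_mul_of_nonneg_left hXsum hm0.le)
    have h2 : s2 * offDiagMass σ Y ≤ 18432 * (n * m * y) := by
      have hτ2 : 0 < τ ^ 2 := by positivity
      rw [hΔ] at h1
      refine le_of_mul_le_mul_right ?_ hτ2
      linarith
    have h3 : offDiagMass σ Y ≤ 18432 * (n * m * y) := by
      have hpos : 0 ≤ offDiagMass σ Y := Finset.sum_nonneg fun i _ => Finset.sum_nonneg fun j _ => by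
        split_ifs
        · exact le_rfl
        · exact hY.1.nonneg i j
      nlinarith
    have h4 : 2 * offDiagMass σ Y / (n * m) ≤ 36864 * y := by
      rw [div_le_iff₀ (by positivity)]
      linarith
    linarith

end Recovery

end ClusterSDP

theorem theorem4 :
    (∃ C : ℝ, 0 < C ∧
      ∀ (n k : ℕ), 4 ≤ n → 2 ≤ k →
      ∀ (σ : Fin n → Fin k), ClusterSDP.IsBalanced σ →
      ∀ (Y : Matrix (Fin n) (Fin n) ℝ) (σhat : Fin n → Fin k),
        ClusterSDP.IsClusterOutput Y σhat →
        ClusterSDP.misRate σhat σ ≤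
          C * (ClusterSDP.l1Norm (Y - ClusterSDP.clusterMatrix σ) /
            ClusterSDP.l1Norm (ClusterSDP.clusterMatrix σ))) ∧
    (∃ Cs Cm Ce : ℝ, 0 < Cs ∧ 0 < Cm ∧ 0 < Ce ∧
      ∀ (n k d : ℕ), 4 ≤ n → 2 ≤ k →
      ∀ (Ω : Type u) [MeasurableSpace Ω] (P : Measure Ω) [IsProbabilityMeasure P]
        (μ : Fin k → EuclideanSpace ℝ (Fin d)) (σ : Fin n → Fin k)
        (g : Fin n → Ω → EuclideanSpace ℝ (Fin d)) (τ : ℝ), 0 < τ →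
        ClusterSDP.IsSGMM P σ g τ →
        Cs * (Real.sqrt ((k : ℝ) * d / n * Real.log n) + (k : ℝ) * d / n + k) ≤
          ClusterSDP.snr μ τ ^ 2 →
        ∃ E : Set Ω, MeasurableSet E ∧ 1 - 2 / (n : ℝ) ≤ P.real E ∧
          ∀ ω ∈ E, ∀ (Y : Matrix (Fin n) (Fin n) ℝ) (σhat : Fin n → Fin k),
            ClusterSDP.IsSDPSolution k
              (ClusterSDP.distMatrix (ClusterSDP.dataPoint μ σ (fun i => g i ω))) Y →
            ClusterSDP.IsClusterOutput Y σhat →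
            ClusterSDP.misRate σhat σ ≤
              Cm * Real.exp (-(ClusterSDP.snr μ τ ^ 2) / Ce)) := by
  -- The constants: 24 = 3 · 8 from the counting and the threshold m/8; 48000 = 1000 · 48 from `hKμ`
  -- with K = 48 τ²(n + d); 884736 = 24 · 2 · (8 · 256 · 9); 32768 = 4 · 8192.
  refine ⟨⟨24, by norm_num, fun n k hn hk σ hσ Y σhat hout =>
    ClusterSDP.misRate_le_l1Norm hn hk hσ hout⟩, 48000, 884736, 32768, by norm_num, by norm_num,
    by norm_num, ?_⟩
  intro n k d hn hk Ω _ P _ μ σ g τ hτ hmodel hs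
  obtain ⟨E, hE, hPE, hEQ⟩ := hmodel.holdsExcept_misRate_le hτ hn hk μ hs
  refine ⟨E, hE, ?_, hEQ⟩
  have h1 : P.real Eᶜ ≤ 2 / n := ENNReal.toReal_le_of_le_ofReal (by positivity) hPE
  rw [probReal_compl_eq_one_sub hE] at h1
  linarith
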